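/- Let $d\ge 1$ and let $\Omega\subset\mathbb R^d$ be a domain (a non-empty connected open set). Let $|\cdot|$ denote Lebesgue measure and let $\tau_d=\pi^{d/2}/\Gamma(d/2+1)$ be the volume of the Euclidean unit ball. Let $W^{\infty,2}(\Omega)=\bigcap_{k\in\mathbb N}W^{k,2}(\Omega)$, where $W^{k,2}(\Omega)$ is the $L^2(\Omega)$-Sobolev space (of complex-valued functions) of order $k$. Let $\kappa\ge 1$ and $l=(l_1,\dots,l_d)\in(0,\infty)^d$, $\|l\|_1=l_1+\dots+l_d$, and let $\{Q_j\}_{j\in J}$ be a $(\kappa,l)$-covering of $\Omega$, that is, a finite or countably infinite family of non-empty bounded convex open subsets $Q_j\subset\Omega$ such that (i) $\Omega\setminus\bigcup_{j\in J}Q_j$ has Lebesgue measure zero; (ii) $\sum_{j\in J}\|g\|_{L^2(Q_j)}^2\le\kappa\|g\|_{L^2(\Omega)}^2$ for all $g\in L^2(\Omega)$; (iii) each $Q_j$ lies in a hyperrectangle with sides of length $l_1,\dots,l_d$ parallel to the coordinate axes. Let $f\in W^{\infty,2}(\Omega)$ satisfy a Bernstein-type inequality with respect to $C_B\colon\mathbb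 N_0\to(0,\infty)$, that is, $$\sum_{|\alpha|=m}\frac1{\alpha!}\|\partial^\alpha f\|_{L^2(\Omega)}^2\le\frac{C_B(m)}{m!}\|f\|_{L^2(\Omega)}^2\quad\text{for all }m\in\mathbb N_0,$$ and suppose that $$h:=\sum_{m\in\mathbb N_0}\sqrt{C_B(m)}\,\frac{(10\|l\|_1)^m}{m!}<\infty.$$ Then, for every measurable subset $\omega\subset\Omega$ and every choice of linear bijections $\Psi_j\colon\mathbb R^d\to\mathbb R^d$, $j\in J$, with $$\nu:=\inf_{j\in J}\frac{|\Psi_j(Q_j\cap\omega)|}{\operatorname{diam}(\Psi_j(Q_j))^d}>0,$$ one has $$\|f\|_{L^2(\Omega)}^2\le\frac{\kappa}{6}\Bigl(\frac{24\,d\,\tau_d}{\nu}\Bigr)^{2\frac{\log\kappa}{\log2}+4\frac{\log h}{\log2}+5}\|f\|_{L^2(\omega)}^2.$$ -/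

import Mathlib

open MeasureTheory Set
open scoped ENNReal

noncomputable section

/-- The classical partial derivative `∂ᵢ φ`. -/
def partialDeriv {d : ℕ} (i : Fin d) (φ : EuclideanSpace ℝ (Fin d) → ℝ) :
    EuclideanSpace ℝ (Fin d) → ℝ :=
  fun x => fderiv ℝ φ x (EuclideanSpace.single i 1)

/-- The classical derivative `∂^α φ = ∂₁^{α₁} ⋯ ∂_d^{α_d} φ` for a multi-index `α`. -/
def multiDeriv {d : ℕ} (α : Fin d → ℕ) (φ : EuclideanSpace ℝ (Fin d) → ℝ) :
    EuclideanSpace ℝ (Fin d) → ℝ :=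
  (List.finRange d).foldr (fun i ψ => (partialDeriv i)^[α i] ψ) φ

/-- `g` is a weak derivative `∂^α f` on the open set `Ω`:
`∫_Ω f ∂^α φ = (-1)^{|α|} ∫_Ω g φ` for all test functions `φ ∈ C_c^∞(Ω)`. -/
def HasWeakDerivOn {d : ℕ} (Ω : Set (EuclideanSpace ℝ (Fin d))) (α : Fin d → ℕ)
    (f g : EuclideanSpace ℝ (Fin d) → ℂ) : Prop :=
  LocallyIntegrableOn f Ω volume ∧ LocallyIntegrableOn g Ω volume ∧
    ∀ φ : EuclideanSpace ℝ (Fin d) → ℝ, ContDiff ℝ (⊤ : ℕ∞) φ → HasCompactSupport φ → tsupport φ ⊆ Ω →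
      ∫ x in Ω, multiDeriv α φ x • f x = (-1) ^ (∑ k, α k) * ∫ x in Ω, φ x • g x

/-- Weak derivatives are unique up to a null set. -/
theorem HasWeakDerivOn.ae_eq {d : ℕ} {Ω : Set (EuclideanSpace ℝ (Fin d))} (hΩ : IsOpen Ω)
    {α : Fin d → ℕ} {f g₁ g₂ : EuclideanSpace ℝ (Fin d) → ℂ}
    (h₁ : HasWeakDerivOn Ω α f g₁) (h₂ : HasWeakDerivOn Ω α f g₂) :
    g₁ =ᵐ[volume.restrict Ω] g₂ := by
  obtain ⟨-, hg₁, h₁⟩ := h₁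
  obtain ⟨-, hg₂, h₂⟩ := h₂
  have key : ∀ᵐ x ∂volume, x ∈ Ω → (g₁ - g₂) x = 0 := by
    refine hΩ.ae_eq_zero_of_integral_contDiff_smul_eq_zero (hg₁.sub hg₂) ?_
    intro φ hφ hc hs
    have hI : ∀ g : EuclideanSpace ℝ (Fin d) → ℂ, LocallyIntegrableOn g Ω volume →
        Integrable (fun x => φ x • g x) volume := fun g hg => by
      have hK : IntegrableOn (fun x => φ x • g x) (tsupport φ) volume :=
        (hg.integrableOn_compact_subset hs hc).continuousOn_smul hφ.continuous.continuousOn hc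
      refine (integrableOn_iff_integrable_of_support_subset fun x hx => ?_).mp hK
      exact subset_tsupport φ fun h0 => hx (by simp [h0])
    have hset : ∀ g : EuclideanSpace ℝ (Fin d) → ℂ,
        ∫ x in Ω, φ x • g x = ∫ x, φ x • g x := fun g =>
      setIntegral_eq_integral_of_forall_compl_eq_zero fun x hx => by
        have : φ x = 0 := image_eq_zero_of_notMem_tsupport fun h => hx (hs h)
        simp [this]
    have e := (h₁ φ hφ hc hs).symm.trans (h₂ φ hφ hc hs)
    rw [hset, hset] at e
    have e' := mul_left_cancel₀ (pow_ne_zero _ (by norm_num)) e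
    simp only [Pi.sub_apply, smul_sub]
    rw [integral_sub (hI _ hg₁) (hI _ hg₂), e', sub_self]
  rw [Filter.EventuallyEq, ae_restrict_iff' hΩ.measurableSet]
  filter_upwards [key] with x hx hxΩ
  exact sub_eq_zero.mp (hx hxΩ)

open Classical in
/-- The weak derivative `∂^α f` on `Ω` (a chosen representative; `0` if there is none). -/
def weakDeriv {d : ℕ} (Ω : Set (EuclideanSpace ℝ (Fin d))) (α : Fin d → ℕ)
    (f : EuclideanSpace ℝ (Fin d) → ℂ) : EuclideanSpace ℝ (Fin d) → ℂ :=
  if h : ∃ g, HasWeakDerivOn Ω α f g then h.choose else 0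

/-- `f ∈ W^{k,2}(Ω)`. -/
def MemSobolevW {d : ℕ} (k : ℕ) (Ω : Set (EuclideanSpace ℝ (Fin d)))
    (f : EuclideanSpace ℝ (Fin d) → ℂ) : Prop :=
  MemLp f 2 (volume.restrict Ω) ∧
    ∀ α : Fin d → ℕ, ∑ i, α i ≤ k →
      ∃ g, MemLp g 2 (volume.restrict Ω) ∧ HasWeakDerivOn Ω α f g

/-- `f ∈ W^{∞,2}(Ω) = ⋂ₖ W^{k,2}(Ω)`. -/
def MemSobolevWInfty {d : ℕ} (Ω : Set (EuclideanSpace ℝ (Fin d)))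
    (f : EuclideanSpace ℝ (Fin d) → ℂ) : Prop :=
  ∀ k : ℕ, MemSobolevW k Ω f

/-- `‖g‖²_{L²(S)}`, as an extended nonnegative number. -/
def l2NormSq {d : ℕ} (S : Set (EuclideanSpace ℝ (Fin d)))
    (g : EuclideanSpace ℝ (Fin d) → ℂ) : ℝ≥0∞ :=
  eLpNorm g 2 (volume.restrict S) ^ 2

/-- The Bernstein-type inequality with respect to `C_B`:
`∑_{|α| = m} (1/α!) ‖∂^α f‖²_{L²(Ω)} ≤ (C_B(m)/m!) ‖f‖²_{L²(Ω)}` for all `m`. -/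
def BernsteinInequality {d : ℕ} (Ω : Set (EuclideanSpace ℝ (Fin d))) (C_B : ℕ → ℝ)
    (f : EuclideanSpace ℝ (Fin d) → ℂ) : Prop :=
  ∀ m : ℕ,
    ∑ α ∈ Finset.piAntidiag (Finset.univ : Finset (Fin d)) m,
        ENNReal.ofReal (1 / ((∏ k, (α k).factorial : ℕ) : ℝ)) * l2NormSq Ω (weakDeriv Ω α f)
      ≤ ENNReal.ofReal (C_B m / (m.factorial : ℝ)) * l2NormSq Ω f

/-- The family `Q` is a `(κ, l)`-covering of `Ω`. -/
structure IsKappaCovering {d : ℕ} {J : Type*} (κ : ℝ) (l : Fin d → ℝ)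
    (Ω : Set (EuclideanSpace ℝ (Fin d))) (Q : J → Set (EuclideanSpace ℝ (Fin d))) : Prop where
  countable : Countable J
  nonempty : ∀ j, (Q j).Nonempty
  bounded : ∀ j, Bornology.IsBounded (Q j)
  convex : ∀ j, Convex ℝ (Q j)
  isOpen : ∀ j, IsOpen (Q j)
  subset : ∀ j, Q j ⊆ Ω
  covers : volume (Ω \ ⋃ j, Q j) = 0
  overlap : ∀ g : EuclideanSpace ℝ (Fin d) → ℂ, MemLp g 2 (volume.restrict Ω) →
    ∑' j, l2NormSq (Q j) g ≤ ENNReal.ofReal κ * l2NormSq Ω g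
  in_rectangle : ∀ j, ∃ y : EuclideanSpace ℝ (Fin d),
    ∀ x ∈ Q j, ∀ k, x k ∈ Ioo (y k) (y k + l k)

/-- The volume `τ_d = π^{d/2} / Γ(d/2 + 1)` of the Euclidean unit ball in `ℝ^d`. -/
def unitBallVolume (d : ℕ) : ℝ :=
  Real.pi ^ ((d : ℝ) / 2) / Real.Gamma ((d : ℝ) / 2 + 1)

end

/-! This is Kovrijkine's scheme for Logvinenko–Sereda inequalities: reduce to good cells, then to
one complex variable.

Call a cell `Q j` good if, for every order m ≥ 1, its weighted sum of squared derivative norms is at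
most 2^(m+1) κ C_B(m)/m! times ‖f‖² on the cell. By the overlap bound and the Bernstein inequality,
the bad cells carry at most the fraction ∑_{m≥1} 2^{-(m+1)} = 1/2 of ‖f‖². It remains to compare
‖f‖² on `Q` and on `Q ∩ ω` for a good cell (`l2NormSq_le_of_bernstein`); summing these estimates
costs κ, absorbing the bad half costs 2.

On a good cell let T be the mean of |f|². Some y has |f(y)|² ≥ T, and by Markov's inequality some x
has all its Taylor coefficients under control. If the set Λ of points of `Q ∩ ω` where |f| is small
filled more than half of `Q ∩ ω`, polar coordinates around Ψ(y) would give a segment from y meeting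
Λ in a long piece (`exists_segment_volume_le`). The Taylor series at x extends f along that segment
to a holomorphic function on a disc of radius greater than 4, bounded there by 2√κ h√T. Such a
function is not small on a set of positive length (`exists_rpow_le_norm_of_measure_pos`), a
contradiction. So |f| is large on at least half of `Q ∩ ω`. Since |Ψ(Q)| ≤ τ_d diam(Ψ(Q))^d, the
volume of `Q` is at most τ_d/ν times that of `Q ∩ ω`, and the local estimate follows.

Pointwise values and Taylor series require smoothness. Instead of choosing a smooth representative
of f, the argument is run for mollifications of f on slightly shrunken cells, with a factor 5/4 lost
in the derivative bounds, and Fatou's lemma passes to the limit. -/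

noncomputable section

/-! ### Holomorphic functions of one variable that are small on a set of positive length -/

/-- A zero-free holomorphic function on the disc of radius `2` bounded by `M` is bounded below on
the unit disc. -/
theorem inv_sq_le_norm_of_ne_zero {g : ℂ → ℂ} {M : ℝ} (hM : 1 < M)
    (hg : DifferentiableOn ℂ g (Metric.ball 0 2)) (hne : ∀ z ∈ Metric.ball (0 : ℂ) 2, g z ≠ 0)
    (hb : ∀ z ∈ Metric.ball (0 : ℂ) 2, ‖g z‖ ≤ M) (h0 : 1 ≤ ‖g 0‖) {z : ℂ} (hz : ‖z‖ ≤ 1) :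
    (M ^ 2)⁻¹ ≤ ‖g z‖ := by
  have hd : DifferentiableOn ℂ (fun z => deriv g z / g z) (Metric.ball 0 2) :=
    (hg.deriv Metric.isOpen_ball).div hg hne
  -- `G` is a logarithm of `g / g 0`: a primitive of the logarithmic derivative, normalised at `0`.
  obtain ⟨G, hG0, hG⟩ := hd.isExactOn_ball.with_val_at 0 0
  have mem0 : (0 : ℂ) ∈ Metric.ball (0 : ℂ) 2 := by simp
  have memz : z ∈ Metric.ball (0 : ℂ) 2 := by
    rw [mem_ball_zero_iff]; linarith
  have hder : ∀ w ∈ Metric.ball (0 : ℂ) 2,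
      HasDerivAt (fun w => g w * Complex.exp (-G w)) 0 w := by
    intro w hw
    have h1 := (hg.differentiableAt (Metric.isOpen_ball.mem_nhds hw)).hasDerivAt
    have h2 := (hG w hw).neg.cexp
    refine (h1.mul h2).congr_deriv ?_
    have h3 : g w * (deriv g w / g w) = deriv g w := mul_div_cancel₀ _ (hne w hw)
    simp only [Pi.neg_apply]
    linear_combination -Complex.exp (-G w) * h3
  have hconst : ∀ w ∈ Metric.ball (0 : ℂ) 2, g w = g 0 * Complex.exp (G w) := by
    intro w hw
    have := (convex_ball (0 : ℂ) 2).is_const_of_fderivWithin_eq_zero (𝕜 := ℂ)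
      (f := fun w => g w * Complex.exp (-G w))
      (fun x hx => (hder x hx).differentiableAt.differentiableWithinAt)
      (fun x hx => by
        rw [fderivWithin_of_isOpen Metric.isOpen_ball hx]
        ext
        simp [(hder x hx).deriv]) hw mem0
    simp only [hG0, neg_zero, Complex.exp_zero, mul_one] at this
    rw [← this, mul_assoc, ← Complex.exp_add]
    simp
  have hnorm : ∀ w ∈ Metric.ball (0 : ℂ) 2, ‖g w‖ = ‖g 0‖ * Real.exp (G w).re := by
    intro w hw
    rw [hconst w hw, norm_mul, Complex.norm_exp]
  have hlogM : 0 < Real.log M := Real.log_pos hM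
  have hre : MapsTo G (Metric.ball 0 2) {z | z.re ≤ Real.log M} := by
    intro w hw
    have h1 := hb w hw
    rw [hnorm w hw] at h1
    have h2 : Real.exp (G w).re ≤ M :=
      (le_mul_of_one_le_left (Real.exp_pos _).le h0).trans h1
    exact (Real.le_log_iff_exp_le (by linarith)).2 h2
  -- Borel–Carathéodory turns the one-sided bound on Re G into a bound on |G|, hence a lower bound
  -- on Re G; radii 1 and 2 give the factor 2, that is, the power `M ^ 2`.
  have hBC := Complex.borelCaratheodory_zero hlogM
    (fun w hw => (hG w hw).differentiableAt.differentiableWithinAt) hre two_pos memz hG0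
  have h3 : 2 * Real.log M * ‖z‖ / (2 - ‖z‖) ≤ 2 * Real.log M := by
    rw [div_le_iff₀ (by linarith)]
    nlinarith [norm_nonneg z]
  have h4 : -(2 * Real.log M) ≤ (G z).re := by
    have := Complex.abs_re_le_norm (G z)
    have := neg_abs_le (G z).re
    linarith
  rw [hnorm z memz]
  calc (M ^ 2)⁻¹ = Real.exp (-(2 * Real.log M)) := by
        rw [Real.exp_neg, mul_comm, Real.exp_mul, Real.exp_log (by linarith)]; norm_num
    _ ≤ Real.exp (G z).re := Real.exp_le_exp.2 h4
    _ ≤ _ := le_mul_of_one_le_left (Real.exp_pos _).le h0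

/-- The maximum principle on the disc of radius `4`. -/
theorem norm_le_of_norm_eq_four {g : ℂ → ℂ} {M R : ℝ} (hR : 4 < R)
    (hg : DifferentiableOn ℂ g (Metric.ball 0 R)) (hb : ∀ z : ℂ, ‖z‖ = 4 → ‖g z‖ ≤ M) {z : ℂ}
    (hz : ‖z‖ ≤ 4) : ‖g z‖ ≤ M := by
  have hsub : Metric.closedBall (0 : ℂ) 4 ⊆ Metric.ball 0 R := Metric.closedBall_subset_ball hR
  refine Complex.norm_le_of_forall_mem_frontier_norm_le (U := Metric.ball 0 4)
    Metric.isBounded_ball ?_ ?_ ?_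
  · refine DifferentiableOn.diffContOnCl ?_
    rw [closure_ball _ (by norm_num)]
    exact hg.mono hsub
  · intro w hw
    rw [frontier_ball _ (by norm_num)] at hw
    exact hb w (by simpa using hw)
  · rw [closure_ball _ (by norm_num)]
    simpa using hz

/-- Dividing out the zeros in the disc of radius `2` by Blaschke factors of the disc of
radius `4`. -/
theorem exists_blaschke_factorization {M R : ℝ} (hR : 4 < R) (k : ℕ) :
    ∀ φ : ℂ → ℂ, DifferentiableOn ℂ φ (Metric.ball 0 R) → (∀ z : ℂ, ‖z‖ = 4 → ‖φ z‖ ≤ M) →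
      φ 0 ≠ 0 → M < 2 ^ k * ‖φ 0‖ →
      ∃ (s : Multiset ℂ) (g : ℂ → ℂ), DifferentiableOn ℂ g (Metric.ball 0 R) ∧
        (∀ z : ℂ, ‖z‖ = 4 → ‖g z‖ ≤ M) ∧ (∀ z ∈ Metric.ball (0 : ℂ) 2, g z ≠ 0) ∧
        2 ^ s.card * ‖φ 0‖ ≤ ‖g 0‖ ∧ (∀ a ∈ s, ‖a‖ < 2) ∧
        ∀ z ∈ Metric.ball (0 : ℂ) R, φ z * (s.map fun a => 16 - (starRingEnd ℂ) a * z).prod =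
          g z * (s.map fun a => 4 * (z - a)).prod := by
  induction k with
  | zero =>
    intro φ hφ hb _ hM
    have := norm_le_of_norm_eq_four hR hφ hb (z := 0) (by simp)
    simp only [pow_zero, one_mul] at hM
    linarith
  | succ k ih =>
    intro φ hφ hb h0 hM
    by_cases hz : ∃ a ∈ Metric.ball (0 : ℂ) 2, φ a = 0
    · obtain ⟨a, ha, hza⟩ := hz
      have ha2 : ‖a‖ < 2 := by simpa using ha
      have ha0 : a ≠ 0 := fun h => h0 (h ▸ hza)
      have haR : a ∈ Metric.ball (0 : ℂ) R := by
        rw [mem_ball_zero_iff]; linarith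
      have hφeq : ∀ z, φ z = (z - a) * dslope φ a z := by
        intro z
        have := sub_smul_dslope φ a z
        rw [hza, sub_zero, smul_eq_mul] at this
        exact this.symm
      -- `φ` divided by the Blaschke factor of `a`: the modulus is unchanged on |z| = 4, while at 0
      -- it is multiplied by 4/|a| > 2. Each zero removed thus uses up one of the `k` doublings that
      -- the maximum principle permits.
      set ψ : ℂ → ℂ := fun z => dslope φ a z * ((16 - (starRingEnd ℂ) a * z) / 4) with hψ
      have hψd : DifferentiableOn ℂ ψ (Metric.ball 0 R) := by
        refine DifferentiableOn.mul ?_ (by fun_prop)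
        exact (Complex.differentiableOn_dslope (Metric.isOpen_ball.mem_nhds haR)).2 hφ
      have hψb : ∀ z : ℂ, ‖z‖ = 4 → ‖ψ z‖ ≤ M := by
        intro z hz
        have h16 : (16 : ℂ) - (starRingEnd ℂ) a * z = z * (starRingEnd ℂ) (z - a) := by
          rw [map_sub, mul_sub, Complex.mul_conj, Complex.normSq_eq_norm_sq, hz]
          push_cast
          ring
        calc ‖ψ z‖ = ‖φ z‖ := by
              rw [hψ, hφeq z]
              simp only [norm_mul, norm_div, h16, RCLike.norm_conj, hz]
              norm_num
              ring
          _ ≤ M := hb z hz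
      have hψ0 : 2 * ‖φ 0‖ ≤ ‖ψ 0‖ := by
        rw [hψ, hφeq 0]
        simp only [norm_mul, zero_sub, norm_neg, mul_zero, sub_zero]
        norm_num
        nlinarith [norm_nonneg (dslope φ a 0)]
      have hφ0 : 0 < ‖φ 0‖ := norm_pos_iff.2 h0
      obtain ⟨s, g, hg, hgb, hgn, hg0, hs, heq⟩ := ih ψ hψd hψb
        (norm_pos_iff.1 (by linarith)) (by
          rw [pow_succ] at hM
          have : (0 : ℝ) < 2 ^ k := by positivity
          nlinarith)
      refine ⟨a ::ₘ s, g, hg, hgb, hgn, ?_, ?_, ?_⟩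
      · rw [Multiset.card_cons, pow_succ]
        have : (0 : ℝ) < 2 ^ s.card := by positivity
        nlinarith
      · intro b hb'
        rcases Multiset.mem_cons.1 hb' with rfl | hb'
        · exact ha2
        · exact hs b hb'
      · intro z hz
        have := heq z hz
        rw [Multiset.map_cons, Multiset.prod_cons, Multiset.map_cons, Multiset.prod_cons, hφeq z]
        calc _ = 4 * (z - a) * (ψ z * (s.map fun a => 16 - (starRingEnd ℂ) a * z).prod) := by
              simp only [hψ]; ring
          _ = _ := by rw [this]; ring
    · push Not at hz
      exact ⟨0, φ, hφ, hb, hz, by simp, by simp, by simp⟩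

/-- The truncated logarithm controlling `log |t - a|` from below has integral `2 r`. -/
theorem integral_indicator_log_sub_log {r : ℝ} (hr : 0 < r) :
    Integrable ((Ioc (-r) r).indicator fun s => Real.log r - Real.log s) ∧
      ∫ s, (Ioc (-r) r).indicator (fun s => Real.log r - Real.log s) s = 2 * r := by
  have hii : IntervalIntegrable (fun s => Real.log r - Real.log s) volume (-r) r :=
    intervalIntegrable_const.sub intervalIntegral.intervalIntegrable_log'
  constructor
  · rw [integrable_indicator_iff measurableSet_Ioc]
    exact (intervalIntegrable_iff_integrableOn_Ioc_of_le (by linarith)).1 hii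
  · rw [integral_indicator measurableSet_Ioc, ← intervalIntegral.integral_of_le (by linarith),
      intervalIntegral.integral_sub intervalIntegrable_const
        intervalIntegral.intervalIntegrable_log', integral_log]
    simp
    ring

/-- On a set of positive length a monic polynomial is large somewhere. -/
theorem exists_le_prod_norm_sub {E : Set ℝ} (hE : MeasurableSet E) (hfin : volume E ≠ ∞)
    {δ : ℝ} (hδ : 0 < δ) (hEδ : volume E = ENNReal.ofReal δ) (s : Multiset ℂ) :
    ∃ t ∈ E, (δ / (2 * Real.exp 1)) ^ s.card ≤ (s.map fun a => ‖(t : ℂ) - a‖).prod := by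
  -- With this `r` the function `W` has integral δ, so one zero lowers the mean of log |t - a| over
  -- `E` by at most 1 below log r. A point doing at least as well as the mean yields r/e = δ/(2e)
  -- per zero.
  set r := δ / 2 with hr
  have hr0 : 0 < r := by positivity
  set W : ℝ → ℝ := (Ioc (-r) r).indicator fun s => Real.log r - Real.log s with hW
  obtain ⟨hWi, hWint⟩ := integral_indicator_log_sub_log hr0
  -- Only almost everywhere: since `Real.log 0 = 0`, the value `W 0 = log r` may be negative.
  have hW0 : 0 ≤ᵐ[volume] W := by
    filter_upwards [compl_mem_ae_iff.2 (measure_singleton (0 : ℝ))] with x hx0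
    by_cases hx : x ∈ Ioc (-r) r
    · rw [hW, indicator_of_mem hx, Pi.zero_apply, sub_nonneg, ← Real.log_abs]
      exact Real.log_le_log (abs_pos.2 hx0) (abs_le.2 ⟨hx.1.le, hx.2⟩)
    · rw [hW, indicator_of_notMem hx, Pi.zero_apply]
  have hpt : ∀ (t : ℝ) (a : ℂ), t ≠ a.re →
      (t : ℂ) - a ≠ 0 ∧ Real.log r - W (t - a.re) ≤ Real.log ‖(t : ℂ) - a‖ := by
    intro t a hta
    have habs : |t - a.re| ≤ ‖(t : ℂ) - a‖ := by
      simpa using Complex.abs_re_le_norm ((t : ℂ) - a)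
    have hpos : 0 < |t - a.re| := abs_pos.2 (sub_ne_zero.2 hta)
    refine ⟨norm_pos_iff.1 (hpos.trans_le habs), ?_⟩
    refine le_trans ?_ (Real.log_le_log hpos habs)
    by_cases hmem : t - a.re ∈ Ioc (-r) r
    · rw [hW, indicator_of_mem hmem, Real.log_abs]
      linarith
    · rw [hW, indicator_of_notMem hmem, sub_zero]
      refine Real.log_le_log hr0 ?_
      by_contra hlt
      exact hmem ⟨(abs_lt.1 (not_le.1 hlt)).1, (abs_lt.1 (not_le.1 hlt)).2.le⟩
  set V : ℝ → ℝ := fun t => (s.map fun a => W (t - a.re)).sum with hV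
  have hVint : Integrable V ∧ ∫ t in E, V t ≤ s.card * (2 * r) := by
    rw [hV]
    clear hV V
    induction s using Multiset.induction with
    | empty => simp
    | cons a s ih =>
      have h1 : Integrable fun t => W (t - a.re) := hWi.comp_sub_right a.re
      simp only [Multiset.map_cons, Multiset.sum_cons, Multiset.card_cons]
      refine ⟨h1.add ih.1, ?_⟩
      rw [integral_add h1.integrableOn ih.1.integrableOn]
      have h2 : ∫ t in E, W (t - a.re) ≤ 2 * r := by
        rw [← hWint, ← integral_sub_right_eq_self W a.re]
        refine setIntegral_le_integral h1 ?_
        exact (measurePreserving_sub_right volume a.re).quasiMeasurePreserving.ae hW0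
      push_cast
      linarith [ih.2]
  -- Real parts of zeros are excluded because there the logarithm of the product would not split.
  have hN : volume.restrict E (Eᶜ ∪ (Complex.re '' {a | a ∈ s})) = 0 := by
    refine measure_union_null ?_ ?_
    · rw [Measure.restrict_apply hE.compl]; simp
    · have hfs : {a | a ∈ s}.Finite := s.finite_toSet
      exact (hfs.image _).measure_zero _
  have hμ : volume.restrict E ≠ 0 := by
    rw [Ne, Measure.restrict_eq_zero, hEδ]
    simpa using hδ
  have : IsFiniteMeasure (volume.restrict E) := ⟨by simpa using hfin.lt_top⟩
  obtain ⟨t, htN, htV⟩ := exists_notMem_null_le_average hμ hVint.1.integrableOn hN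
  simp only [mem_union, mem_compl_iff, not_or, not_not] at htN
  refine ⟨t, htN.1, ?_⟩
  have hVt : V t ≤ s.card := by
    refine htV.trans ?_
    rw [average_eq, measureReal_restrict_apply_univ, Measure.real, hEδ, ENNReal.toReal_ofReal hδ.le,
      smul_eq_mul, inv_mul_le_iff₀ hδ]
    refine hVint.2.trans (le_of_eq ?_)
    rw [hr]; ring
  have hne : ∀ a ∈ s, t ≠ a.re := fun a ha h => htN.2 ⟨a, ha, h.symm⟩
  have hprod : ∀ u : Multiset ℂ, (∀ a ∈ u, t ≠ a.re) →
      0 < (u.map fun a => ‖(t : ℂ) - a‖).prod ∧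
      u.card * Real.log r - (u.map fun a => W (t - a.re)).sum ≤
        Real.log (u.map fun a => ‖(t : ℂ) - a‖).prod := by
    intro u
    induction u using Multiset.induction with
    | empty => simp
    | cons a u ih =>
      intro hu
      obtain ⟨h1, h2⟩ := hpt t a (hu a (Multiset.mem_cons_self a u))
      obtain ⟨h3, h4⟩ := ih fun b hb => hu b (Multiset.mem_cons_of_mem hb)
      have h5 : 0 < ‖(t : ℂ) - a‖ := norm_pos_iff.2 h1
      simp only [Multiset.map_cons, Multiset.sum_cons, Multiset.card_cons, Multiset.prod_cons]
      refine ⟨mul_pos h5 h3, ?_⟩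
      rw [Real.log_mul h5.ne' h3.ne']
      push_cast
      linarith
  obtain ⟨hp, hlog⟩ := hprod s hne
  rw [← Real.log_le_log_iff (by positivity) hp, Real.log_pow, ← div_div,
    Real.log_div (by positivity) (Real.exp_ne_zero 1), Real.log_exp]
  calc _ = s.card * Real.log r - s.card := by rw [hr]; ring
    _ ≤ _ := by linarith

/-- A holomorphic function with `1 ≤ ‖φ 0‖` that is bounded by `M` on the disc of radius `4` is
not small on any subset of `[0, 1]` of positive length. -/
theorem exists_rpow_le_norm_of_measure_pos {φ : ℂ → ℂ} {M R : ℝ} (hR : 4 < R) (hM : 1 < M)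
    (hφ : DifferentiableOn ℂ φ (Metric.ball 0 R)) (hb : ∀ z : ℂ, ‖z‖ = 4 → ‖φ z‖ ≤ M)
    (h0 : 1 ≤ ‖φ 0‖) {E : Set ℝ} (hE : MeasurableSet E) (hE1 : E ⊆ Icc 0 1)
    {δ : ℝ} (hδ : 0 < δ) (hEδ : ENNReal.ofReal δ ≤ volume E) :
    ∃ t ∈ E, (δ / 12) ^ (2 * (Real.log M / Real.log 2)) ≤ ‖φ t‖ := by
  have hEle : volume E ≤ 1 := (measure_mono hE1).trans (by simp)
  have hfin : volume E ≠ ∞ := ne_top_of_le_ne_top ENNReal.one_ne_top hEle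
  set δ' := (volume E).toReal with hδ'
  have hEδ' : volume E = ENNReal.ofReal δ' := (ENNReal.ofReal_toReal hfin).symm
  have hle : δ ≤ δ' := (ENNReal.ofReal_le_iff_le_toReal hfin).1 hEδ
  have hδ'1 : δ' ≤ 1 := ENNReal.toReal_le_of_le_ofReal one_pos.le (by simpa using hEle)
  have hδ'0 : 0 < δ' := hδ.trans_le hle
  obtain ⟨k, hk⟩ := pow_unbounded_of_one_lt (M / ‖φ 0‖) one_lt_two
  obtain ⟨s, g, hg, hgb, hgn, hg0, hs, heq⟩ := exists_blaschke_factorization hR k φ hφ hb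
    (norm_pos_iff.1 (by linarith)) ((div_lt_iff₀ (by linarith)).1 hk)
  obtain ⟨t, htE, ht⟩ := exists_le_prod_norm_sub hE hfin hδ'0 hEδ' s
  refine ⟨t, htE, ?_⟩
  have ht1 : ‖(t : ℂ)‖ ≤ 1 := by
    rw [Complex.norm_real, Real.norm_eq_abs, abs_of_nonneg (hE1 htE).1]
    exact (hE1 htE).2
  have hcard : (2 : ℝ) ^ s.card ≤ M := by
    have h1 := norm_le_of_norm_eq_four hR hg hgb (z := 0) (by simp)
    have : (0 : ℝ) < 2 ^ s.card := by positivity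
    nlinarith
  have hg1 : 1 ≤ ‖g 0‖ := by
    have : (1 : ℝ) ≤ 2 ^ s.card := one_le_pow₀ (by norm_num)
    nlinarith
  have hgt : (M ^ 2)⁻¹ ≤ ‖g t‖ := by
    refine inv_sq_le_norm_of_ne_zero hM (hg.mono (Metric.ball_subset_ball (by linarith))) hgn ?_
      hg1 ht1
    intro w hw
    exact norm_le_of_norm_eq_four hR hg hgb (by
      have : ‖w‖ < 2 := by simpa using hw
      linarith)
  have hprod : ∀ u : Multiset ℂ, (∀ a ∈ u, ‖a‖ < 2) →
      ‖(u.map fun a => 16 - (starRingEnd ℂ) a * (t : ℂ)).prod‖ ≤ 18 ^ u.card ∧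
      ‖(u.map fun a => 4 * ((t : ℂ) - a)).prod‖ =
        4 ^ u.card * (u.map fun a => ‖(t : ℂ) - a‖).prod := by
    intro u
    induction u using Multiset.induction with
    | empty => simp
    | cons a u ih =>
      intro hu
      obtain ⟨h3, h4⟩ := ih fun b hb => hu b (Multiset.mem_cons_of_mem hb)
      simp only [Multiset.map_cons, Multiset.card_cons, Multiset.prod_cons, norm_mul, h4, pow_succ]
      constructor
      · rw [mul_comm]
        refine mul_le_mul h3 ?_ (norm_nonneg _) (by positivity)
        calc ‖16 - (starRingEnd ℂ) a * (t : ℂ)‖ ≤ ‖(16 : ℂ)‖ + ‖(starRingEnd ℂ) a * (t : ℂ)‖ :=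
              norm_sub_le _ _
          _ ≤ 16 + 2 * 1 := by
              rw [norm_mul, RCLike.norm_conj]
              have := hu a (Multiset.mem_cons_self a u)
              gcongr
              norm_num
          _ = 18 := by norm_num
      · norm_num
        ring
  obtain ⟨hp1, hp2⟩ := hprod s hs
  set n := s.card with hn
  -- Each inverse Blaschke factor contributes at least 4|t - a|/18, and 4/18 · δ'/(2e) = δ'/(9e).
  have hmain : (M ^ 2)⁻¹ * (δ' / (9 * Real.exp 1)) ^ n ≤ ‖φ t‖ := by
    have h1 : ‖φ t‖ * ‖(s.map fun a => 16 - (starRingEnd ℂ) a * (t : ℂ)).prod‖ =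
        ‖g t‖ * (4 ^ n * (s.map fun a => ‖(t : ℂ) - a‖).prod) := by
      rw [← hp2, ← norm_mul, ← norm_mul, heq t (by rw [mem_ball_zero_iff]; linarith)]
    have h2 : (M ^ 2)⁻¹ * (4 ^ n * (δ' / (2 * Real.exp 1)) ^ n) ≤ ‖φ t‖ * 18 ^ n := by
      calc _ ≤ ‖g t‖ * (4 ^ n * (s.map fun a => ‖(t : ℂ) - a‖).prod) := by gcongr
        _ ≤ _ := by rw [← h1]; gcongr
    have h3 : (δ' / (9 * Real.exp 1)) ^ n * 18 ^ n = 4 ^ n * (δ' / (2 * Real.exp 1)) ^ n := by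
      rw [← mul_pow, ← mul_pow]
      congr 1
      field_simp
      norm_num
    have h4 : (0 : ℝ) < 18 ^ n := by positivity
    rw [← h3, ← mul_assoc] at h2
    exact le_of_mul_le_mul_right h2 h4
  have he := Real.exp_one_lt_three
  have hlog2 : 0 < Real.log 2 := Real.log_pos one_lt_two
  set L := Real.log M / Real.log 2 with hL
  have hnL : (n : ℝ) ≤ L := by
    rw [hL, le_div_iff₀ hlog2, ← Real.log_pow]
    exact Real.log_le_log (by positivity) hcard
  have hL0 : 0 ≤ L := (Nat.cast_nonneg n).trans hnL
  have hpos : 0 < (M ^ 2)⁻¹ * (δ' / (9 * Real.exp 1)) ^ n := by positivity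
  refine le_trans ?_ hmain
  rw [← Real.log_le_log_iff (by positivity) hpos, Real.log_rpow (by positivity),
    Real.log_mul (by positivity) (by positivity), Real.log_inv, Real.log_pow, Real.log_pow]
  have hlogM : Real.log M = L * Real.log 2 := by rw [hL]; field_simp
  have hneg : Real.log (δ' / (9 * Real.exp 1)) ≤ 0 := by
    refine Real.log_nonpos (by positivity) ?_
    rw [div_le_one (by positivity)]
    linarith [Real.add_one_le_exp (1 : ℝ)]
  -- `M ^ 2 = 2 ^ (2 * L)` is charged as a factor 4 to each of `L` units, and `L` bounds the number
  -- of zeros. One unit then costs δ'/(36e), which is at least (δ/12)² because e < 4 and δ ≤ δ' ≤ 1.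
  have h5 : 2 * Real.log (δ / 12) ≤ Real.log (δ' / (9 * Real.exp 1)) - 2 * Real.log 2 := by
    have e1 : 2 * Real.log (δ / 12) = Real.log ((δ / 12) ^ 2) := by rw [Real.log_pow]; norm_num
    have e2 : 2 * Real.log 2 = Real.log (2 ^ 2) := by rw [Real.log_pow]; norm_num
    rw [e1, e2, ← Real.log_div (by positivity) (by positivity)]
    refine Real.log_le_log (by positivity) ?_
    rw [div_div, le_div_iff₀ (by positivity)]
    have : δ ^ 2 ≤ δ' := by nlinarith
    have : (δ / 12) ^ 2 * (9 * Real.exp 1 * 2 ^ 2) = δ ^ 2 * (Real.exp 1 / 4) := by ring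
    rw [this]
    nlinarith [Real.exp_pos 1]
  rw [hlogM]
  push_cast
  nlinarith [mul_le_mul_of_nonneg_left h5 hL0, mul_le_mul_of_nonpos_right hnL hneg]

/-! ### Polar coordinates: long intersections with a segment -/

theorem volume_unit_ball_eq (d : ℕ) (hd : 1 ≤ d) :
    volume (Metric.ball (0 : EuclideanSpace ℝ (Fin d)) 1) = ENNReal.ofReal (unitBallVolume d) := by
  have : Nonempty (Fin d) := ⟨⟨0, hd⟩⟩
  rw [EuclideanSpace.volume_ball, unitBallVolume, Real.rpow_div_two_eq_sqrt _ Real.pi_pos.le]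
  simp

theorem unitBallVolume_pos (d : ℕ) : 0 < unitBallVolume d := by
  have := Real.Gamma_pos_of_pos (s := (d : ℝ) / 2 + 1) (by positivity)
  have := Real.pi_pos
  unfold unitBallVolume
  positivity

/-- Polar coordinates: some ray from `y` meets a given set in a long piece. -/
theorem exists_direction_volume_le {d : ℕ} (hd : 1 ≤ d) {A : Set (EuclideanSpace ℝ (Fin d))}
    (hA : MeasurableSet A) (y : EuclideanSpace ℝ (Fin d)) {D : ℝ}
    (hAD : A ⊆ Metric.closedBall y D) :
    ∃ θ : EuclideanSpace ℝ (Fin d), ‖θ‖ = 1 ∧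
      volume A ≤ ENNReal.ofReal (d * unitBallVolume d * D ^ (d - 1)) *
        volume {r : ℝ | 0 < r ∧ y + r • θ ∈ A} := by
  have hne : Nonempty (Fin d) := ⟨⟨0, hd⟩⟩
  have hnt : Nontrivial (EuclideanSpace ℝ (Fin d)) := by
    refine Module.nontrivial_of_finrank_pos (R := ℝ) ?_
    rw [finrank_euclideanSpace_fin]; exact hd
  set μ : Measure (EuclideanSpace ℝ (Fin d)) := volume with hμ
  set B : Set (EuclideanSpace ℝ (Fin d)) := (fun x => y + x) ⁻¹' A with hB
  have hBm : MeasurableSet B := hA.preimage (measurable_const_add y)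
  have hBA : μ B = μ A := measure_preimage_add μ y A
  have hBD : ∀ x ∈ B, ‖x‖ ≤ D := by
    intro x hx
    have := hAD hx
    simpa [Metric.mem_closedBall, dist_eq_norm] using this
  have hmp := μ.measurePreserving_homeomorphUnitSphereProd
  set P : Set (Metric.sphere (0 : EuclideanSpace ℝ (Fin d)) 1 × Ioi (0 : ℝ)) :=
    {p | (p.2 : ℝ) • (p.1 : EuclideanSpace ℝ (Fin d)) ∈ B} with hP
  have hPm : MeasurableSet P := by
    have : Continuous fun p : Metric.sphere (0 : EuclideanSpace ℝ (Fin d)) 1 × Ioi (0 : ℝ) =>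
      (p.2 : ℝ) • (p.1 : EuclideanSpace ℝ (Fin d)) := by fun_prop
    exact hBm.preimage this.measurable
  have hpre : homeomorphUnitSphereProd (EuclideanSpace ℝ (Fin d)) ⁻¹' P =
      Subtype.val ⁻¹' B := by
    ext x
    have hx : ‖(x : EuclideanSpace ℝ (Fin d))‖ ≠ 0 := norm_ne_zero_iff.2 x.2
    simp [hP, smul_smul, hx]
  have hvol : μ A = ∫⁻ θ, Measure.volumeIoiPow (d - 1) (Prod.mk θ ⁻¹' P) ∂μ.toSphere := by
    have h1 := hmp.measure_preimage hPm.nullMeasurableSet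
    rw [hpre, comap_subtype_coe_apply (measurableSet_singleton _).compl,
      Subtype.image_preimage_coe, finrank_euclideanSpace_fin, Measure.prod_apply hPm] at h1
    rw [← h1, ← hBA, inter_comm, ← sdiff_eq, measure_sdiff_null (measure_singleton _)]
  have hfin : μ A ≠ ∞ := ((measure_mono hAD).trans_lt measure_closedBall_lt_top).ne
  -- A direction whose radial slice has at least the average weight over the sphere, whose total
  -- measure is d·τ_d.
  obtain ⟨θ, hθ⟩ := exists_laverage_le (Measure.toSphere_ne_zero μ) (hvol ▸ hfin)
  refine ⟨θ, by simp, ?_⟩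
  set T : Set ℝ := {r : ℝ | 0 < r ∧ y + r • (θ : EuclideanSpace ℝ (Fin d)) ∈ A} with hT
  have hslice : Measure.volumeIoiPow (d - 1) (Prod.mk θ ⁻¹' P) ≤
      ENNReal.ofReal (D ^ (d - 1)) * volume T := by
    have hm : MeasurableSet (Prod.mk θ ⁻¹' P) := measurable_prodMk_left hPm
    have himg : Subtype.val '' (Prod.mk θ ⁻¹' P) = T := by
      ext r
      constructor
      · rintro ⟨s, hs, rfl⟩
        exact ⟨s.2, hs⟩
      · rintro ⟨hr, hrA⟩
        exact ⟨⟨r, hr⟩, hrA, rfl⟩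
    rw [Measure.volumeIoiPow, withDensity_apply _ hm,
      setLIntegral_subtype measurableSet_Ioi _ fun a : ℝ ↦ .ofReal (a ^ (d - 1)), himg]
    refine (setLIntegral_mono measurable_const fun r hr => ?_).trans_eq (setLIntegral_const _ _)
    refine ENNReal.ofReal_le_ofReal (pow_le_pow_left₀ hr.1.le ?_ _)
    have := hBD _ (show r • (θ : EuclideanSpace ℝ (Fin d)) ∈ B from hr.2)
    simpa [norm_smul, abs_of_pos hr.1] using this
  have huniv : μ.toSphere univ = ENNReal.ofReal (d * unitBallVolume d) := by
    rw [Measure.toSphere_apply_univ, finrank_euclideanSpace_fin, volume_unit_ball_eq d hd,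
      ENNReal.ofReal_mul (by positivity), ENNReal.ofReal_natCast]
  calc μ A = μ.toSphere univ *
        ⨍⁻ θ, Measure.volumeIoiPow (d - 1) (Prod.mk θ ⁻¹' P) ∂μ.toSphere := by
        rw [measure_mul_laverage, hvol]
    _ ≤ ENNReal.ofReal (d * unitBallVolume d) * (ENNReal.ofReal (D ^ (d - 1)) * volume T) := by
        rw [← huniv]
        gcongr
        exact hθ.trans hslice
    _ = _ := by
        rw [← mul_assoc, ← ENNReal.ofReal_mul]
        exact mul_nonneg (Nat.cast_nonneg _) (unitBallVolume_pos d).le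

/-- Some segment starting at `y` meets a given set of positive measure in a large portion. -/
theorem exists_segment_volume_le {d : ℕ} (hd : 1 ≤ d) {A : Set (EuclideanSpace ℝ (Fin d))}
    (hA : MeasurableSet A) (hA0 : volume A ≠ 0) (y : EuclideanSpace ℝ (Fin d)) {D : ℝ}
    (hAD : A ⊆ Metric.closedBall y D) :
    ∃ v : EuclideanSpace ℝ (Fin d), y + v ∈ closure A ∧
      ∃ E : Set ℝ, MeasurableSet E ∧ E ⊆ Icc 0 1 ∧ (∀ t ∈ E, y + t • v ∈ A) ∧
        volume A ≤ ENNReal.ofReal (d * unitBallVolume d * D ^ d) * volume E := by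
  obtain ⟨θ, hθ, hvol⟩ := exists_direction_volume_le hd hA y hAD
  set T : Set ℝ := {r : ℝ | 0 < r ∧ y + r • θ ∈ A} with hT
  have hTm : MeasurableSet T := by
    have : Continuous fun r : ℝ => y + r • θ := by fun_prop
    exact measurableSet_Ioi.inter (hA.preimage this.measurable)
  have hTD : ∀ r ∈ T, r ≤ D := by
    intro r hr
    have := hAD hr.2
    simpa [Metric.mem_closedBall, dist_eq_norm, norm_smul, hθ, abs_of_pos hr.1] using this
  have hTne : T.Nonempty := by
    rw [nonempty_iff_ne_empty]
    intro h
    rw [h, measure_empty, mul_zero] at hvol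
    exact hA0 (le_antisymm hvol bot_le)
  have hbdd : BddAbove T := ⟨D, hTD⟩
  -- The segment ends at the last point of the ray in the closure of `A`, so that its endpoint
  -- inherits closed constraints from `A`. Rescaling to `[0, 1]` divides lengths by `R ≤ D`, which
  -- turns `D ^ (d - 1)` into `D ^ d`.
  set R := sSup T with hR
  have hR0 : 0 < R := by
    obtain ⟨r, hr⟩ := hTne
    exact hr.1.trans_le (le_csSup hbdd hr)
  have hRD : R ≤ D := csSup_le hTne hTD
  have hD : 0 < D := hR0.trans_le hRD
  refine ⟨R • θ, ?_, (fun t : ℝ => R * t) ⁻¹' T, hTm.preimage (measurable_const_mul R), ?_, ?_, ?_⟩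
  · have hc : Continuous fun r : ℝ => y + r • θ := by fun_prop
    exact map_mem_closure (f := fun r : ℝ => y + r • θ) hc (csSup_mem_closure hTne hbdd) fun r hr => hr.2
  · intro t ht
    have h1 : 0 < R * t := ht.1
    have h2 : R * t ≤ R := le_csSup hbdd ht
    exact ⟨(pos_of_mul_pos_right h1 hR0.le).le, by nlinarith⟩
  · intro t ht
    have h1 : y + (R * t) • θ ∈ A := ht.2
    rwa [mul_comm, mul_smul] at h1
  · have hτ := unitBallVolume_pos d
    rw [Real.volume_preimage_mul_left hR0.ne', ← mul_assoc, abs_of_pos (inv_pos.2 hR0)]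
    refine hvol.trans ?_
    rw [← ENNReal.ofReal_mul (by positivity)]
    · gcongr ENNReal.ofReal ?_ * _
      obtain ⟨m, rfl⟩ : ∃ m, d = m + 1 := ⟨d - 1, by omega⟩
      rw [Nat.add_sub_cancel, pow_succ]
      have : 1 ≤ D * R⁻¹ := by
        rw [← div_eq_mul_inv, le_div_iff₀ hR0]
        linarith
      calc _ = ((m + 1 : ℕ) : ℝ) * unitBallVolume (m + 1) * D ^ m * 1 := by ring
        _ ≤ ((m + 1 : ℕ) : ℝ) * unitBallVolume (m + 1) * D ^ m * (D * R⁻¹) := by gcongr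
        _ = _ := by ring

/-! ### Taylor polynomials and convergence of Taylor series -/

/-- The factorial `α!` of a multi-index, as a real number. -/
def multiFactorial {d : ℕ} (α : Fin d → ℕ) : ℝ := ((∏ k, (α k).factorial : ℕ) : ℝ)

/-- The weighted square sum `∑_{|α| = m} |c_α|² / α!`. -/
def jetNormSq {d : ℕ} (c : (Fin d → ℕ) → ℂ) (m : ℕ) : ℝ :=
  ∑ α ∈ Finset.piAntidiag (Finset.univ : Finset (Fin d)) m, ‖c α‖ ^ 2 / multiFactorial α

/-- The homogeneous Taylor polynomial `∑_{|α| = m} w^α c_α / α!`. -/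
def jetPoly {d : ℕ} (c : (Fin d → ℕ) → ℂ) (m : ℕ) (w : Fin d → ℂ) : ℂ :=
  ∑ α ∈ Finset.piAntidiag (Finset.univ : Finset (Fin d)) m,
    ((∏ k, w k ^ α k) / multiFactorial α) * c α

theorem multiFactorial_pos {d : ℕ} (α : Fin d → ℕ) : 0 < multiFactorial α := by
  unfold multiFactorial
  exact_mod_cast Finset.prod_pos fun k _ => Nat.factorial_pos _

theorem multiFactorial_add_single {d : ℕ} (α : Fin d → ℕ) (i : Fin d) :
    multiFactorial (α + Pi.single i 1) = (α i + 1) * multiFactorial α := by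
  unfold multiFactorial
  rw [← Finset.mul_prod_erase _ _ (Finset.mem_univ i),
    ← Finset.mul_prod_erase Finset.univ (fun k => (α k).factorial) (Finset.mem_univ i)]
  have : ∀ k ∈ Finset.univ.erase i,
      ((α + Pi.single i 1 : Fin d → ℕ) k).factorial = (α k).factorial := by
    intro k hk
    simp [Pi.single_eq_of_ne (Finset.ne_of_mem_erase hk)]
  rw [Finset.prod_congr rfl this]
  simp [Nat.factorial_succ]
  ring

theorem jetNormSq_zero {d : ℕ} (c : (Fin d → ℕ) → ℂ) : jetNormSq c 0 = ‖c 0‖ ^ 2 := by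
  simp [jetNormSq, multiFactorial]

theorem jetPoly_zero {d : ℕ} (c : (Fin d → ℕ) → ℂ) (w : Fin d → ℂ) : jetPoly c 0 w = c 0 := by
  simp [jetPoly, multiFactorial]

/-- Reindexing of sums over multi-indices of order `m` and `m + 1`. -/
theorem sum_piAntidiag_add_single {d : ℕ} (m : ℕ) (c : (Fin d → ℕ) → ℂ) :
    ∑ α ∈ Finset.piAntidiag (Finset.univ : Finset (Fin d)) m,
        ∑ i, c (α + Pi.single i 1) / multiFactorial α =
      (m + 1) * ∑ β ∈ Finset.piAntidiag (Finset.univ : Finset (Fin d)) (m + 1),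
        c β / multiFactorial β := by
  rw [Finset.sum_comm, Finset.mul_sum]
  have h1 : ∀ i : Fin d,
      ∑ α ∈ Finset.piAntidiag (Finset.univ : Finset (Fin d)) m,
        c (α + Pi.single i 1) / (multiFactorial α : ℂ) =
      ∑ β ∈ Finset.piAntidiag (Finset.univ : Finset (Fin d)) (m + 1),
        (β i : ℂ) * (c β / multiFactorial β) := by
    intro i
    refine Finset.sum_of_injOn (fun α => α + Pi.single i 1) ?_ ?_ ?_ ?_
    · intro a _ b _ h
      exact add_right_cancel h
    · intro α hα
      simp only [Finset.mem_coe, Finset.mem_piAntidiag] at hα ⊢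
      simp [Finset.sum_add_distrib, hα.1]
    · intro β hβ hn
      have : β i = 0 := by
        by_contra h0
        apply hn
        refine ⟨β - Pi.single i 1, ?_, ?_⟩
        · simp only [Finset.mem_coe, Finset.mem_piAntidiag] at hβ ⊢
          refine ⟨?_, by simp⟩
          have h2 : β = (β - Pi.single i 1) + Pi.single i 1 := by
            funext k
            by_cases hk : k = i
            · subst hk; simp; omega
            · simp [Pi.single_eq_of_ne hk]
          have h3 := hβ.1
          rw [h2] at h3
          simp only [Pi.add_apply, Finset.sum_add_distrib] at h3
          simp at h3
          simpa using h3
        · funext k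
          by_cases hk : k = i
          · subst hk; simp; omega
          · simp [Pi.single_eq_of_ne hk]
      rw [this]; simp
    · intro α _
      rw [multiFactorial_add_single]
      have : (multiFactorial α : ℂ) ≠ 0 := by exact_mod_cast (multiFactorial_pos α).ne'
      have h4 : (α i : ℂ) + 1 ≠ 0 := Nat.cast_add_one_ne_zero _
      simp only [Pi.add_apply, Pi.single_eq_same]
      push_cast
      field_simp
  rw [Finset.sum_congr rfl fun i _ => h1 i, Finset.sum_comm]
  refine Finset.sum_congr rfl fun β hβ => ?_
  rw [← Finset.sum_mul, ← Nat.cast_sum, (Finset.mem_piAntidiag.1 hβ).1]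
  push_cast
  ring

/-- Cauchy-Schwarz for homogeneous Taylor polynomials. -/
theorem norm_jetPoly_le {d : ℕ} (c : (Fin d → ℕ) → ℂ) (m : ℕ) (w : Fin d → ℂ) {B : ℝ}
    (hB : ∑ k, ‖w k‖ ≤ B) :
    ‖jetPoly c m w‖ ≤ √(jetNormSq c m) * (B ^ m / √(m.factorial : ℝ)) := by
  have hB0 : 0 ≤ B := (Finset.sum_nonneg fun k _ => norm_nonneg _).trans hB
  have h1 : ‖jetPoly c m w‖ ≤ ∑ α ∈ Finset.piAntidiag (Finset.univ : Finset (Fin d)) m,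
      (‖c α‖ / √(multiFactorial α)) * ((∏ k, ‖w k‖ ^ α k) / √(multiFactorial α)) := by
    refine (norm_sum_le _ _).trans (Finset.sum_le_sum fun α _ => le_of_eq ?_)
    have hp := multiFactorial_pos α
    rw [norm_mul, norm_div, norm_prod, Complex.norm_real, Real.norm_eq_abs, abs_of_pos hp]
    simp only [norm_pow]
    rw [div_mul_div_comm, Real.mul_self_sqrt hp.le]
    ring
  refine h1.trans ((Real.sum_mul_le_sqrt_mul_sqrt _ _ _).trans ?_)
  have h2 : ∑ α ∈ Finset.piAntidiag (Finset.univ : Finset (Fin d)) m,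
      (‖c α‖ / √(multiFactorial α)) ^ 2 = jetNormSq c m := by
    refine Finset.sum_congr rfl fun α _ => ?_
    rw [div_pow, Real.sq_sqrt (multiFactorial_pos α).le]
  -- The multinomial theorem; the 1/m! it produces is the source of the `√(m.factorial)` in the
  -- bound.
  have h3 : ∑ α ∈ Finset.piAntidiag (Finset.univ : Finset (Fin d)) m,
      ((∏ k, ‖w k‖ ^ α k) / √(multiFactorial α)) ^ 2 = (∑ k, ‖w k‖ ^ 2) ^ m / m.factorial := by
    rw [Finset.sum_pow_eq_sum_piAntidiag, Finset.sum_div]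
    refine Finset.sum_congr rfl fun α hα => ?_
    have hm : (Nat.multinomial Finset.univ α : ℝ) * multiFactorial α = m.factorial := by
      have := Nat.multinomial_spec Finset.univ α
      rw [(Finset.mem_piAntidiag.1 hα).1] at this
      rw [← this, multiFactorial]
      push_cast
      ring
    rw [div_pow, Real.sq_sqrt (multiFactorial_pos α).le, ← hm, ← Finset.prod_pow]
    have h4 := (multiFactorial_pos α).ne'
    have h5 : (Nat.multinomial Finset.univ α : ℝ) ≠ 0 := by
      exact_mod_cast (Nat.multinomial_pos _ _).ne'
    simp only [← pow_mul, mul_comm 2]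
    field_simp
  rw [h2, h3]
  refine mul_le_mul_of_nonneg_left ?_ (Real.sqrt_nonneg _)
  rw [Real.sqrt_div' _ (by positivity)]
  gcongr
  rw [Real.sqrt_le_left (by positivity), ← pow_mul, mul_comm m 2, pow_mul]
  gcongr
  calc ∑ k, ‖w k‖ ^ 2 ≤ (∑ k, ‖w k‖) ^ 2 :=
        Finset.sum_sq_le_sq_sum_of_nonneg fun k _ => norm_nonneg _
    _ ≤ B ^ 2 := by
        have : 0 ≤ ∑ k, ‖w k‖ := Finset.sum_nonneg fun k _ => norm_nonneg _
        gcongr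

/-- `F` behaves on `S` like the family of all partial derivatives of `F 0`. -/
def IsJetOn {d : ℕ} (F : (Fin d → ℕ) → EuclideanSpace ℝ (Fin d) → ℂ)
    (S : Set (EuclideanSpace ℝ (Fin d))) : Prop :=
  ∀ α, ∀ x ∈ S, ∃ F' : EuclideanSpace ℝ (Fin d) →L[ℝ] ℂ, HasFDerivAt (F α) F' x ∧
    ∀ i, F' (EuclideanSpace.single i 1) = F (α + Pi.single i 1) x

/-- The m-th Taylor term in direction u is (1/m!) times the m-th directional derivative, so one more
derivative along u produces the factor m + 1. In coordinates this is the chain rule followed by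
`sum_piAntidiag_add_single`. -/
theorem IsJetOn.hasDerivAt_jetPoly {d : ℕ} {F : (Fin d → ℕ) → EuclideanSpace ℝ (Fin d) → ℂ}
    {S : Set (EuclideanSpace ℝ (Fin d))} (hF : IsJetOn F S) (m : ℕ)
    (x u : EuclideanSpace ℝ (Fin d)) (s : ℝ) (hs : x + s • u ∈ S) :
    HasDerivAt (fun s : ℝ => jetPoly (fun α => F α (x + s • u)) m fun k => (u k : ℂ))
      ((m + 1) * jetPoly (fun α => F α (x + s • u)) (m + 1) fun k => (u k : ℂ)) s := by
  have h1 : ∀ α, HasDerivAt (fun s : ℝ => F α (x + s • u))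
      (∑ i, (u i : ℂ) * F (α + Pi.single i 1) (x + s • u)) s := by
    intro α
    obtain ⟨F', hF', hi⟩ := hF α _ hs
    have h2 : HasDerivAt (fun s : ℝ => x + s • u) u s := by
      simpa using ((hasDerivAt_id s).smul_const u).const_add x
    refine (hF'.comp_hasDerivAt s h2).congr_deriv ?_
    have h3 : u = ∑ i, u i • EuclideanSpace.single i (1 : ℝ) := by
      ext k
      simp [Finset.sum_apply, Pi.single_apply]
    conv_lhs => rw [h3]
    simp [map_sum, hi]
  unfold jetPoly
  refine (HasDerivAt.fun_sum fun α _ => (h1 α).const_mul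
    ((∏ k, (u k : ℂ) ^ α k) / (multiFactorial α : ℂ))).congr_deriv ?_
  have h4 := sum_piAntidiag_add_single m fun β => (∏ k, (u k : ℂ) ^ β k) * F β (x + s • u)
  convert h4 using 1
  · refine Finset.sum_congr rfl fun α _ => ?_
    rw [Finset.mul_sum]
    refine Finset.sum_congr rfl fun i _ => ?_
    have : ∏ k, (u k : ℂ) ^ (α + Pi.single i 1 : Fin d → ℕ) k = (∏ k, (u k : ℂ) ^ α k) * u i := by
      simp only [Pi.add_apply, pow_add, Finset.prod_mul_distrib]
      congr 1
      rw [Finset.prod_eq_single i] <;> simp +contextual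
    rw [this]
    ring
  · congr 1
    refine Finset.sum_congr rfl fun α _ => ?_
    ring

/-- Taylor's formula with a crude remainder. -/
theorem IsJetOn.norm_sub_sum_jetPoly_le {d : ℕ}
    {F : (Fin d → ℕ) → EuclideanSpace ℝ (Fin d) → ℂ}
    {S : Set (EuclideanSpace ℝ (Fin d))} (hF : IsJetOn F S) (hS : Convex ℝ S)
    {x u : EuclideanSpace ℝ (Fin d)} (hx : x ∈ S) (hxu : x + u ∈ S) (n : ℕ) {K : ℝ}
    (hK : ∀ y ∈ S, ‖jetPoly (fun α => F α y) (n + 1) fun k => (u k : ℂ)‖ ≤ K) :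
    ‖F 0 (x + u) - ∑ m ∈ Finset.range (n + 1),
      jetPoly (fun α => F α x) m fun k => (u k : ℂ)‖ ≤ (n + 1) * K := by
  set G : ℕ → ℝ → ℂ := fun m s => jetPoly (fun α => F α (x + s • u)) m fun k => (u k : ℂ) with hG
  have hmem : ∀ s ∈ Icc (0 : ℝ) 1, x + s • u ∈ S := fun s hs =>
    hS.add_smul_mem hx hxu hs
  -- The Taylor polynomial based at `x + s • u`, evaluated at `x + u`. It moves from the polynomial
  -- at `x` to the value at `x + u`, and its `s`-derivative telescopes to one term of order `n + 1`.
  -- Bounding (1 - s)^n by 1 leaves the factor `n + 1`.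
  set H : ℕ → ℝ → ℂ := fun n s => ∑ m ∈ Finset.range (n + 1), ((1 : ℂ) - s) ^ m * G m s with hH
  have hder : ∀ n : ℕ, ∀ s ∈ Icc (0 : ℝ) 1,
      HasDerivAt (H n) (((1 : ℂ) - s) ^ n * ((n + 1) * G (n + 1) s)) s := by
    intro n s hs
    have hg : ∀ m : ℕ, HasDerivAt (G m) ((m + 1) * G (m + 1) s) s := fun m =>
      hF.hasDerivAt_jetPoly m x u s (hmem s hs)
    have hp : ∀ m : ℕ, HasDerivAt (fun s : ℝ => ((1 : ℂ) - s) ^ (m + 1))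
        (-((m + 1) * ((1 : ℂ) - s) ^ m)) s := by
      intro m
      have h1 : HasDerivAt (fun s : ℝ => (1 : ℂ) - s) (-1) s := by
        simpa using (Complex.ofRealCLM.hasDerivAt (x := s)).const_sub (1 : ℂ)
      refine (h1.pow (m + 1)).congr_deriv ?_
      push_cast
      simp
    induction n with
    | zero =>
      simpa [hH] using hg 0
    | succ n ih =>
      have h2 := ih.add ((hp n).mul (hg (n + 1)))
      have h3 : H (n + 1) = H n + fun s : ℝ => ((1 : ℂ) - s) ^ (n + 1) * G (n + 1) s := by
        funext s
        simp only [hH, Pi.add_apply]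
        rw [Finset.sum_range_succ]
      rw [h3]
      refine h2.congr_deriv ?_
      push_cast
      ring
  have hK0 : 0 ≤ K := (norm_nonneg _).trans (hK x hx)
  have hmv := norm_image_sub_le_of_norm_deriv_le_segment_01' (f := H n) (C := (n + 1) * K)
    (fun s hs => (hder n s hs).hasDerivWithinAt) (fun s hs => by
      have h1 : ‖(1 : ℂ) - s‖ ≤ 1 := by
        rw [← Complex.ofReal_one, ← Complex.ofReal_sub, Complex.norm_real, Real.norm_eq_abs,
          abs_le]
        constructor <;> linarith [hs.1, hs.2]
      have h2 : ‖G (n + 1) s‖ ≤ K := hK _ (hmem s ⟨hs.1, hs.2.le⟩)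
      have h3 : ‖((n : ℂ) + 1)‖ = n + 1 := by
        rw [← Nat.cast_add_one, Complex.norm_natCast]; push_cast; ring
      rw [norm_mul, norm_mul, norm_pow, h3]
      calc _ ≤ 1 * ((n + 1) * K) := by
            gcongr
            exact pow_le_one₀ (norm_nonneg _) h1
        _ = _ := one_mul _)
  have hH1 : H n 1 = F 0 (x + u) := by
    simp only [hH, hG, Complex.ofReal_one, sub_self, one_smul]
    rw [Finset.sum_eq_single 0]
    · simp [jetPoly_zero]
    · intro m _ hm
      simp [hm]
    · simp
  have hH0 : H n 0 = ∑ m ∈ Finset.range (n + 1),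
      jetPoly (fun α => F α x) m fun k => (u k : ℂ) := by
    simp [hH, hG]
  rwa [hH1, hH0] at hmv

/-- Growth `4 ^ m` of squared jets doubles the effective radius `B`. With radius 5‖l‖₁, needed for
complex segments, this gives the 10‖l‖₁ in `h`. -/
theorem sqrt_mul_pow_div_sqrt_factorial {K C : ℝ} (hK : 0 ≤ K) (B : ℝ) (m : ℕ) :
    √(K * (4 ^ m * (C / (m.factorial : ℝ)))) * (B ^ m / √(m.factorial : ℝ)) =
      √K * (√C * ((2 * B) ^ m / (m.factorial : ℝ))) := by
  have h1 : (0 : ℝ) < m.factorial := by exact_mod_cast m.factorial_pos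
  have h2 : √((4 : ℝ) ^ m) = 2 ^ m := by
    rw [show (4 : ℝ) = 2 ^ 2 by norm_num, ← pow_mul, mul_comm 2 m, pow_mul,
      Real.sqrt_sq (by positivity)]
  rw [Real.sqrt_mul hK, Real.sqrt_mul (by positivity), Real.sqrt_div' _ h1.le, h2, mul_pow]
  have h3 := Real.mul_self_sqrt h1.le
  have h5 : √K * (2 ^ m * (√C / √(m.factorial : ℝ))) * (B ^ m / √(m.factorial : ℝ)) =
      √K * (√C * (2 ^ m * B ^ m / (√(m.factorial : ℝ) * √(m.factorial : ℝ)))) := by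
    field_simp
  rw [h5, h3]

/-- The Taylor series converges under bounds of Bernstein type. -/
theorem IsJetOn.hasSum_jetPoly {d : ℕ} {F : (Fin d → ℕ) → EuclideanSpace ℝ (Fin d) → ℂ}
    {S : Set (EuclideanSpace ℝ (Fin d))} (hF : IsJetOn F S) (hS : Convex ℝ S) {C : ℕ → ℝ}
    {B K : ℝ} (hB : 0 ≤ B) (hK : 0 ≤ K)
    (hsum : Summable fun m : ℕ => √(C m) * ((10 * B) ^ m / (m.factorial : ℝ)))
    (hsup : ∀ m, ∀ y ∈ S, jetNormSq (fun α => F α y) m ≤ K * (4 ^ m * (C m / (m.factorial : ℝ))))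
    {x u : EuclideanSpace ℝ (Fin d)} (hx : x ∈ S) (hxu : x + u ∈ S) (hu : ∑ k, |u k| ≤ 2 * B) :
    HasSum (fun m => jetPoly (fun α => F α x) m fun k => (u k : ℂ)) (F 0 (x + u)) := by
  have hbd : ∀ m, ∀ y ∈ S, ‖jetPoly (fun α => F α y) m fun k => (u k : ℂ)‖ ≤
      √K * (√(C m) * ((2 * (2 * B)) ^ m / (m.factorial : ℝ))) := by
    intro m y hy
    rw [← sqrt_mul_pow_div_sqrt_factorial hK]
    refine (norm_jetPoly_le _ m _ (B := 2 * B) (by simpa using hu)).trans ?_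
    gcongr
    exact hsup m y hy
  have hle : ∀ m : ℕ, √K * (√(C m) * ((2 * (2 * B)) ^ m / (m.factorial : ℝ))) ≤
      √K * (√(C m) * ((10 * B) ^ m / (m.factorial : ℝ))) := by
    intro m
    gcongr √K * (√(C m) * (?_ ^ m / _))
    linarith
  have hs : Summable fun m => jetPoly (fun α => F α x) m fun k => (u k : ℂ) :=
    Summable.of_norm_bounded (hsum.mul_left (√K)) fun m => (hbd m x hx).trans (hle m)
  rw [hs.hasSum_iff_tendsto_nat, ← Filter.tendsto_add_atTop_iff_nat 1, tendsto_iff_norm_sub_tendsto_zero]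
  have hz := ((hsum.mul_left (√K)).tendsto_atTop_zero).comp (Filter.tendsto_add_atTop_nat 1)
  refine squeeze_zero (fun n => norm_nonneg _) (fun n => ?_) hz
  rw [norm_sub_rev]
  refine (hF.norm_sub_sum_jetPoly_le hS hx hxu n (hbd (n + 1))).trans ?_
  -- Real points need only radius 4B after doubling; the slack 10/4 = 5/2 absorbs the factor `n + 1`
  -- of the crude remainder.
  have h1 : ((n : ℝ) + 1) * (2 * (2 * B)) ^ (n + 1) ≤ (10 * B) ^ (n + 1) := by
    have h2 : ((n : ℝ) + 1) ≤ (5 / 2) ^ (n + 1) := by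
      have := one_add_mul_le_pow (show (-2 : ℝ) ≤ 3 / 2 by norm_num) (n + 1)
      norm_num at this
      linarith [(Nat.cast_nonneg n : (0 : ℝ) ≤ n)]
    calc _ ≤ (5 / 2) ^ (n + 1) * (2 * (2 * B)) ^ (n + 1) := by gcongr
      _ = _ := by rw [← mul_pow]; ring
  calc _ = √K * (√(C (n + 1)) * (((n : ℝ) + 1) * (2 * (2 * B)) ^ (n + 1) / ((n + 1).factorial : ℝ))) := by
        ring
    _ ≤ _ := by
        simp only [Function.comp]
        gcongr

/-! ### The local estimate for smooth functions -/

/-- The restriction of a function with Bernstein bounds at `x` to a segment starting at `y` cannot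
be small on a subset of positive length. -/
theorem IsJetOn.exists_le_norm_segment {d : ℕ}
    {F : (Fin d → ℕ) → EuclideanSpace ℝ (Fin d) → ℂ}
    {S : Set (EuclideanSpace ℝ (Fin d))} (hF : IsJetOn F S) (hS : Convex ℝ S) {C : ℕ → ℝ}
    {l : Fin d → ℝ} {K κ T h : ℝ} (hl : 0 < ∑ k, l k) (hK : 0 ≤ K) (hκ : 1 ≤ κ) (hT : 0 < T)
    (hsum : Summable fun m : ℕ => √(C m) * ((10 * ∑ k, l k) ^ m / (m.factorial : ℝ)))
    (hh : h = ∑' m : ℕ, √(C m) * ((10 * ∑ k, l k) ^ m / (m.factorial : ℝ))) (hh1 : 1 ≤ h)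
    (hsup : ∀ m, ∀ y ∈ S, jetNormSq (fun α => F α y) m ≤ K * (4 ^ m * (C m / (m.factorial : ℝ))))
    {x y v : EuclideanSpace ℝ (Fin d)} (hx : x ∈ S) (hy : y ∈ S)
    (hgood : ∀ m, jetNormSq (fun α => F α x) m ≤
      κ * T * (4 ^ (m + 1) * (C m / (m.factorial : ℝ))))
    (hyT : T ≤ ‖F 0 y‖ ^ 2) (hxy : ∀ k, |y k - x k| < l k) (hv : ∀ k, |v k| ≤ l k)
    {E : Set ℝ} (hE : MeasurableSet E) (hE1 : E ⊆ Icc 0 1) (hES : ∀ t ∈ E, y + t • v ∈ S)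
    {δ : ℝ} (hδ : 0 < δ) (hEδ : ENNReal.ofReal δ ≤ volume E) :
    ∃ t ∈ E, √T * (δ / 12) ^ (2 * (Real.log (2 * √κ * h) / Real.log 2)) ≤ ‖F 0 (y + t • v)‖ := by
  set B := ∑ k, l k with hB
  have hd : (Finset.univ : Finset (Fin d)).Nonempty := by
    rw [Finset.nonempty_iff_ne_empty]
    intro h0
    rw [hB, h0] at hl
    simp at hl
  have hb : ∑ k, |y k - x k| < B := Finset.sum_lt_sum_of_nonempty hd fun k _ => hxy k
  set b := ∑ k, |y k - x k| with hb'
  -- The largest radius with `b + R * B = 5 * B`; it exceeds 4 because `x` and `y` differ by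
  -- strictly less than `l` in each coordinate.
  set R := 4 + (B - b) / B with hR
  have hR4 : 4 < R := by
    have : 0 < (B - b) / B := div_pos (by linarith) hl
    linarith
  have hRB : b + R * B = 5 * B := by
    rw [hR]; field_simp; ring
  set w : ℂ → Fin d → ℂ := fun z k => ((y k - x k : ℝ) : ℂ) + z * (v k : ℂ) with hw
  have hwB : ∀ z ∈ Metric.ball (0 : ℂ) R, ∑ k, ‖w z k‖ ≤ 5 * B := by
    intro z hz
    have hz' : ‖z‖ ≤ R := (by simpa using hz : ‖z‖ < R).le
    calc ∑ k, ‖w z k‖ ≤ ∑ k, (|y k - x k| + R * l k) := by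
          refine Finset.sum_le_sum fun k _ => (norm_add_le _ _).trans ?_
          rw [norm_mul, Complex.norm_real, Complex.norm_real, Real.norm_eq_abs, Real.norm_eq_abs]
          have := hv k
          gcongr
      _ = 5 * B := by rw [Finset.sum_add_distrib, ← Finset.mul_sum, hRB]
  set φ : ℂ → ℂ := fun z => ∑' m, jetPoly (fun α => F α x) m (w z) with hφ
  set q : ℕ → ℝ := fun m => √(C m) * ((10 * B) ^ m / (m.factorial : ℝ)) with hq
  have hbd : ∀ m, ∀ z ∈ Metric.ball (0 : ℂ) R,
      ‖jetPoly (fun α => F α x) m (w z)‖ ≤ 2 * √κ * √T * q m := by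
    intro m z hz
    refine (norm_jetPoly_le _ m _ (hwB z hz)).trans ?_
    have h1 : 2 * √κ * √T = √(4 * κ * T) := by
      rw [Real.sqrt_mul (by positivity), Real.sqrt_mul (by norm_num),
        show (4 : ℝ) = 2 ^ 2 by norm_num, Real.sqrt_sq (by norm_num)]
    have h2 : 2 * √κ * √T * q m =
        √((4 * κ * T) * (4 ^ m * (C m / (m.factorial : ℝ)))) *
          ((5 * B) ^ m / √(m.factorial : ℝ)) := by
      rw [sqrt_mul_pow_div_sqrt_factorial (by positivity), h1, hq]
      simp only []
      congr 4
      ring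
    rw [h2]
    gcongr
    refine (hgood m).trans (le_of_eq ?_)
    rw [pow_succ]; ring
  have hsum' : Summable fun m => 2 * √κ * √T * q m := hsum.mul_left _
  have hφd : DifferentiableOn ℂ φ (Metric.ball 0 R) := by
    refine Complex.differentiableOn_tsum_of_summable_norm hsum' (fun m => ?_) Metric.isOpen_ball
      fun m z hz => hbd m z hz
    unfold jetPoly
    simp only [hw]
    fun_prop
  have hφb : ∀ z ∈ Metric.ball (0 : ℂ) R, ‖φ z‖ ≤ √T * (2 * √κ * h) := by
    intro z hz
    have h1 : ‖φ z‖ ≤ ∑' m, 2 * √κ * √T * q m :=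
      tsum_of_norm_bounded hsum'.hasSum fun m => hbd m z hz
    rw [tsum_mul_left, ← hh] at h1
    linarith
  -- At real points the series really represents `F 0`: the ℓ¹-distance from `x` to `y + t • v` is
  -- at most 2B, within the range of `IsJetOn.hasSum_jetPoly`.
  have hφt : ∀ t : ℝ, t ∈ Icc (0 : ℝ) 1 → y + t • v ∈ S → φ t = F 0 (y + t • v) := by
    intro t ht hmem
    have hu : ∑ k, |(y + t • v - x) k| ≤ 2 * B := by
      calc ∑ k, |(y + t • v - x) k| ≤ ∑ k, (|y k - x k| + l k) := by
            refine Finset.sum_le_sum fun k _ => ?_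
            have h1 : (y + t • v - x) k = (y k - x k) + t * v k := by
              simp; ring
            rw [h1]
            refine (abs_add_le _ _).trans ?_
            rw [abs_mul, abs_of_nonneg ht.1]
            have := hv k
            have : t * |v k| ≤ 1 * |v k| := by
              gcongr
              exact ht.2
            linarith
        _ ≤ 2 * B := by rw [Finset.sum_add_distrib]; linarith
    have h2 := hF.hasSum_jetPoly hS hl.le hK hsum hsup hx
      (show x + (y + t • v - x) ∈ S by rwa [add_sub_cancel]) hu
    rw [add_sub_cancel] at h2
    rw [← h2.tsum_eq]
    simp only [hφ, hw]
    congr 1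
    funext m
    congr 1
    funext k
    simp
    ring
  have hsT : 0 < √T := Real.sqrt_pos.2 hT
  have hsTc : (√T : ℂ) ≠ 0 := by exact_mod_cast hsT.ne'
  have hκ1 : 1 ≤ √κ := Real.one_le_sqrt.2 hκ
  have hnorm : ∀ z, ‖φ z / (√T : ℂ)‖ = ‖φ z‖ / √T := by
    intro z
    rw [norm_div, Complex.norm_real, Real.norm_eq_abs, abs_of_pos hsT]
  obtain ⟨t, htE, ht⟩ := exists_rpow_le_norm_of_measure_pos (φ := fun z => φ z / (√T : ℂ))
    (M := 2 * √κ * h) hR4 (by nlinarith) (hφd.div_const _)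
    (fun z hz => by
      rw [hnorm, div_le_iff₀ hsT, mul_comm]
      exact hφb z (by rw [mem_ball_zero_iff]; linarith))
    (by
      have h1 := hφt 0 ⟨le_rfl, zero_le_one⟩ (by simpa using hy)
      simp only [Complex.ofReal_zero, zero_smul, add_zero] at h1
      rw [hnorm, le_div_iff₀ hsT, one_mul, h1]
      exact Real.sqrt_le_left (norm_nonneg _) |>.2 hyT)
    hE hE1 hδ hEδ
  refine ⟨t, htE, ?_⟩
  rw [hnorm, le_div_iff₀ hsT, hφt t (hE1 htE) (hES t htE)] at ht
  rwa [mul_comm]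

theorem exists_volume_image_linearEquiv_eq {d : ℕ}
    (Ψ : EuclideanSpace ℝ (Fin d) ≃ₗ[ℝ] EuclideanSpace ℝ (Fin d)) :
    ∃ c : ℝ≥0∞, c ≠ 0 ∧ c ≠ ∞ ∧ ∀ s : Set (EuclideanSpace ℝ (Fin d)),
      volume (Ψ '' s) = c * volume s := by
  refine ⟨ENNReal.ofReal |LinearMap.det (Ψ : EuclideanSpace ℝ (Fin d) →ₗ[ℝ] _)|, ?_,
    ENNReal.ofReal_ne_top, fun s => ?_⟩
  · have := (LinearEquiv.isUnit_det' Ψ).ne_zero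
    simpa using this
  · exact Measure.addHaar_image_linearMap volume (Ψ : EuclideanSpace ℝ (Fin d) →ₗ[ℝ] _) s

theorem measurableSet_image_linearEquiv {d : ℕ}
    (Ψ : EuclideanSpace ℝ (Fin d) ≃ₗ[ℝ] EuclideanSpace ℝ (Fin d))
    {s : Set (EuclideanSpace ℝ (Fin d))} (hs : MeasurableSet s) : MeasurableSet (Ψ '' s) := by
  have h1 : Ψ '' s = Ψ.symm ⁻¹' s := Ψ.toEquiv.image_eq_preimage_symm s
  rw [h1]
  exact hs.preimage Ψ.symm.toContinuousLinearEquiv.continuous.measurable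

/-- If each of countably many functions has a suitably small integral, then some point lies outside
all the corresponding superlevel sets. -/
theorem exists_forall_le_of_lintegral_le {d : ℕ} {S : Set (EuclideanSpace ℝ (Fin d))}
    (hV0 : volume S ≠ 0) (hVfin : volume S ≠ ∞) (g : ℕ → EuclideanSpace ℝ (Fin d) → ℝ)
    (hg : ∀ m, Measurable (g m)) (b : ℕ → ℝ) (hb : ∀ m, 0 < b m)
    (h0 : ∫⁻ x in S, ENNReal.ofReal (g 0 x) ≤ ENNReal.ofReal (1 / 4 * b 0) * volume S)
    (h1 : ∀ m, ∫⁻ x in S, ENNReal.ofReal (g (m + 1) x) ≤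
      ENNReal.ofReal (5 / 16 * (1 / 2) ^ m * b (m + 1)) * volume S) :
    ∃ x ∈ S, ∀ m, g m x ≤ b m := by
  set bad : ℕ → Set (EuclideanSpace ℝ (Fin d)) := fun m => {x | b m < g m x} with hbad
  have hmarkov : ∀ m (r : ℝ), 0 ≤ r →
      ∫⁻ x in S, ENNReal.ofReal (g m x) ≤ ENNReal.ofReal (r * b m) * volume S →
      volume.restrict S (bad m) ≤ ENNReal.ofReal r * volume S := by
    intro m r hr hle
    have h2 := mul_meas_ge_le_lintegral₀ (μ := volume.restrict S)
      (hg m).ennreal_ofReal.aemeasurable (ENNReal.ofReal (b m))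
    have h3 : bad m ⊆ {x | ENNReal.ofReal (b m) ≤ ENNReal.ofReal (g m x)} := by
      intro x hx
      exact ENNReal.ofReal_le_ofReal (le_of_lt hx)
    have hb0 : ENNReal.ofReal (b m) ≠ 0 := by simpa using hb m
    rw [← ENNReal.mul_le_mul_iff_right hb0 ENNReal.ofReal_ne_top]
    calc _ ≤ ENNReal.ofReal (b m) *
          volume.restrict S {x | ENNReal.ofReal (b m) ≤ ENNReal.ofReal (g m x)} := by gcongr
      _ ≤ _ := h2.trans hle
      _ = _ := by rw [mul_comm r, ENNReal.ofReal_mul (hb m).le, mul_assoc]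
  -- The exceptional sets occupy at most 1/4 + 5/16 · 2 = 7/8 of `S`.
  have hun : volume.restrict S (bad 0 ∪ ⋃ m, bad (m + 1)) ≤ ENNReal.ofReal (7 / 8) * volume S := by
    have hgeo : ∑' m : ℕ, ENNReal.ofReal (5 / 16 * (1 / 2) ^ m) = ENNReal.ofReal (5 / 8) := by
      rw [← ENNReal.ofReal_tsum_of_nonneg (fun m => by positivity)
        (summable_geometric_two.mul_left _), tsum_mul_left, tsum_geometric_two]
      norm_num
    calc _ ≤ volume.restrict S (bad 0) + ∑' m, volume.restrict S (bad (m + 1)) :=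
          (measure_union_le _ _).trans (by gcongr; exact measure_iUnion_le _)
      _ ≤ ENNReal.ofReal (1 / 4) * volume S +
          ∑' m : ℕ, ENNReal.ofReal (5 / 16 * (1 / 2) ^ m) * volume S := by
          gcongr with m
          · exact hmarkov 0 _ (by norm_num) h0
          · exact hmarkov (m + 1) _ (by positivity) (h1 m)
      _ = _ := by
          rw [ENNReal.tsum_mul_right, hgeo, ← add_mul, ← ENNReal.ofReal_add (by norm_num)
            (by norm_num)]
          norm_num
  by_contra hcon
  push Not at hcon
  have hsub : S ⊆ bad 0 ∪ ⋃ m, bad (m + 1) := by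
    intro x hx
    obtain ⟨m, hm⟩ := hcon x hx
    cases m with
    | zero => exact Or.inl hm
    | succ m => exact Or.inr (mem_iUnion.2 ⟨m, hm⟩)
  have h2 : volume S ≤ volume.restrict S (bad 0 ∪ ⋃ m, bad (m + 1)) := by
    calc volume S = volume.restrict S S := by simp
      _ ≤ _ := measure_mono hsub
  have h3 : ENNReal.ofReal (7 / 8) * volume S < 1 * volume S := by
    refine ENNReal.mul_lt_mul_left hV0 hVfin ?_
    rw [ENNReal.ofReal_lt_one]; norm_num
  rw [one_mul] at h3
  exact absurd (h2.trans hun) (not_le.2 h3)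

theorem continuous_jetNormSq {d : ℕ} {F : (Fin d → ℕ) → EuclideanSpace ℝ (Fin d) → ℂ}
    (hF : ∀ α, Continuous (F α)) (m : ℕ) : Continuous fun x => jetNormSq (fun α => F α x) m := by
  unfold jetNormSq
  fun_prop

/-- The sublevel set of `F 0` at a suitable level occupies at most half of `S ∩ ω`. -/
theorem IsJetOn.two_mul_volume_sublevel_le {d : ℕ} (hd : 1 ≤ d)
    {F : (Fin d → ℕ) → EuclideanSpace ℝ (Fin d) → ℂ} {S ω : Set (EuclideanSpace ℝ (Fin d))}
    (hF : IsJetOn F S) (hFc : ∀ α, Continuous (F α)) (hS : Convex ℝ S) (hSm : MeasurableSet S)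
    (hω : MeasurableSet ω) {C : ℕ → ℝ} {l : Fin d → ℝ} {K κ T h c D : ℝ}
    (hl : ∀ k, 0 < l k) (hK : 0 ≤ K) (hκ : 1 ≤ κ) (hT : 0 < T)
    (hsum : Summable fun m : ℕ => √(C m) * ((10 * ∑ k, l k) ^ m / (m.factorial : ℝ)))
    (hh : h = ∑' m : ℕ, √(C m) * ((10 * ∑ k, l k) ^ m / (m.factorial : ℝ))) (hh1 : 1 ≤ h)
    (hsup : ∀ m, ∀ y ∈ S, jetNormSq (fun α => F α y) m ≤ K * (4 ^ m * (C m / (m.factorial : ℝ))))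
    {x y p : EuclideanSpace ℝ (Fin d)} (hx : x ∈ S) (hy : y ∈ S)
    (hgood : ∀ m, jetNormSq (fun α => F α x) m ≤
      κ * T * (4 ^ (m + 1) * (C m / (m.factorial : ℝ))))
    (hyT : T ≤ ‖F 0 y‖ ^ 2) (hbox : ∀ x ∈ S, ∀ k, x k ∈ Ioo (p k) (p k + l k))
    (Ψ : EuclideanSpace ℝ (Fin d) ≃ₗ[ℝ] EuclideanSpace ℝ (Fin d)) (hc : 0 < c) (hD : 0 < D)
    (hdiam : ∀ x ∈ S, ∀ y ∈ S, dist (Ψ x) (Ψ y) ≤ D)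
    (hvol : ENNReal.ofReal (c * D ^ d) ≤ volume (Ψ '' (S ∩ ω))) :
    2 * volume {x ∈ S ∩ ω | ‖F 0 x‖ < √T * (c / (24 * d * unitBallVolume d)) ^
      (2 * (Real.log (2 * √κ * h) / Real.log 2))} ≤ volume (S ∩ ω) := by
  have hdp : (0 : ℝ) < d := by exact_mod_cast hd
  have hτ := unitBallVolume_pos d
  have hl0 : 0 < ∑ k, l k :=
    Finset.sum_pos (fun k _ => hl k) ⟨⟨0, hd⟩, Finset.mem_univ _⟩
  set Λ : Set (EuclideanSpace ℝ (Fin d)) := {x ∈ S ∩ ω | ‖F 0 x‖ < √T *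
    (c / (24 * d * unitBallVolume d)) ^ (2 * (Real.log (2 * √κ * h) / Real.log 2))} with hΛ
  have hΛm : MeasurableSet Λ :=
    (hSm.inter hω).inter (measurableSet_lt (hFc 0).norm.measurable measurable_const)
  have hΛS : Λ ⊆ S := fun x hx => hx.1.1
  by_contra hcon
  rw [not_le] at hcon
  obtain ⟨c₁, hc0, hctop, hcΨ⟩ := exists_volume_image_linearEquiv_eq Ψ
  have hbig : ENNReal.ofReal (c * D ^ d) ≤ 2 * volume (Ψ '' Λ) := by
    refine hvol.trans ?_
    rw [hcΨ, hcΨ, mul_left_comm]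
    gcongr
  have hΨΛ0 : volume (Ψ '' Λ) ≠ 0 := by
    intro h0
    rw [h0, mul_zero, nonpos_iff_eq_zero, ENNReal.ofReal_eq_zero] at hbig
    have : 0 < c * D ^ d := by positivity
    linarith
  obtain ⟨v, hv, E, hE, hE1, hEΛ, hEvol⟩ := exists_segment_volume_le hd
    (measurableSet_image_linearEquiv Ψ hΛm) hΨΛ0 (Ψ y) (D := D) (by
      rintro _ ⟨x, hx, rfl⟩
      exact hdiam x (hΛS hx) y hy)
  have hcont : Continuous Ψ.symm := Ψ.symm.toContinuousLinearEquiv.continuous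
  have hyv : y + Ψ.symm v ∈ closure Λ := by
    have h2 := map_mem_closure hcont hv (t := Λ) (by
      rintro _ ⟨x, hx, rfl⟩
      simpa using hx)
    simpa using h2
  have hEΛ' : ∀ t ∈ E, y + t • Ψ.symm v ∈ Λ := by
    intro t ht
    obtain ⟨x, hx, hxe⟩ := hEΛ t ht
    have : x = y + t • Ψ.symm v := by
      rw [← Ψ.symm_apply_apply x, hxe]
      simp
    rwa [← this]
  -- The far endpoint lies only in the closure of Λ, hence in the closed box; this still gives `|v
  -- k| ≤ l k`.
  have hclosed : ∀ k, (y + Ψ.symm v) k ∈ Icc (p k) (p k + l k) := by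
    intro k
    have h3 : IsClosed {x : EuclideanSpace ℝ (Fin d) | x k ∈ Icc (p k) (p k + l k)} :=
      isClosed_Icc.preimage (by fun_prop)
    have h4 : Λ ⊆ {x : EuclideanSpace ℝ (Fin d) | x k ∈ Icc (p k) (p k + l k)} := fun x hx =>
      ⟨(hbox x (hΛS hx) k).1.le, (hbox x (hΛS hx) k).2.le⟩
    exact closure_minimal h4 h3 hyv
  -- If Λ exceeded half of `S ∩ ω`, its image would have volume at least c·D^d/2, so the segment
  -- meets Λ in proportion at least c/(2dτ_d). Division by 12 then gives the constant 24.
  have hEδ : ENNReal.ofReal (c / (2 * (d * unitBallVolume d))) ≤ volume E := by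
    have h4 : ENNReal.ofReal (2 * (d * unitBallVolume d * D ^ d)) *
        ENNReal.ofReal (c / (2 * (d * unitBallVolume d))) ≤
        ENNReal.ofReal (2 * (d * unitBallVolume d * D ^ d)) * volume E := by
      rw [← ENNReal.ofReal_mul (by positivity)]
      calc _ = ENNReal.ofReal (c * D ^ d) := by
            congr 1
            field_simp
        _ ≤ 2 * (ENNReal.ofReal (d * unitBallVolume d * D ^ d) * volume E) := by
            refine hbig.trans ?_
            gcongr
        _ = _ := by
            rw [ENNReal.ofReal_mul two_pos.le, ENNReal.ofReal_ofNat, ← mul_assoc]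
    rwa [ENNReal.mul_le_mul_iff_right _ ENNReal.ofReal_ne_top] at h4
    have : 0 < 2 * (d * unitBallVolume d * D ^ d) := by positivity
    simpa using this
  obtain ⟨t, ht, hlt⟩ := hF.exists_le_norm_segment hS hl0 hK hκ hT hsum hh hh1 hsup hx hy hgood
    hyT (v := Ψ.symm v)
    (fun k => by
      have h5 := hbox x hx k
      have h6 := hbox y hy k
      rw [abs_lt]
      constructor <;> linarith [h5.1, h5.2, h6.1, h6.2])
    (fun k => by
      have h5 := hclosed k
      have h6 := hbox y hy k
      rw [PiLp.add_apply] at h5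
      rw [abs_le]
      constructor <;> linarith [h5.1, h5.2, h6.1, h6.2])
    hE hE1 (fun t ht => hΛS (hEΛ' t ht)) (δ := c / (2 * (d * unitBallVolume d)))
    (by positivity) hEδ
  have h7 : c / (2 * (d * unitBallVolume d)) / 12 = c / (24 * d * unitBallVolume d) := by
    rw [div_div]; congr 1; ring
  rw [h7] at hlt
  exact absurd (hEΛ' t ht).2 (not_lt.2 hlt)

/-- The local estimate for smooth functions. -/
theorem IsJetOn.lintegral_enorm_sq_le {d : ℕ} (hd : 1 ≤ d)
    {F : (Fin d → ℕ) → EuclideanSpace ℝ (Fin d) → ℂ} {S ω : Set (EuclideanSpace ℝ (Fin d))}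
    (hF : IsJetOn F S) (hFc : ∀ α, Continuous (F α)) (hS : Convex ℝ S) (hSm : MeasurableSet S)
    (hω : MeasurableSet ω) {C : ℕ → ℝ} {l : Fin d → ℝ} {K κ h c D : ℝ} (hC : ∀ m, 0 < C m)
    (hC0 : 1 ≤ C 0) (hl : ∀ k, 0 < l k) (hK : 0 ≤ K) (hκ : 1 ≤ κ)
    (hsum : Summable fun m : ℕ => √(C m) * ((10 * ∑ k, l k) ^ m / (m.factorial : ℝ)))
    (hh : h = ∑' m : ℕ, √(C m) * ((10 * ∑ k, l k) ^ m / (m.factorial : ℝ))) (hh1 : 1 ≤ h)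
    (hsup : ∀ m, ∀ y ∈ S, jetNormSq (fun α => F α y) m ≤ K * (4 ^ m * (C m / (m.factorial : ℝ))))
    (hint : ∀ m, ∫⁻ x in S, ENNReal.ofReal (jetNormSq (fun α => F α x) (m + 1)) ≤
      ENNReal.ofReal (5 / 4 * (2 ^ (m + 2) * κ * (C (m + 1) / ((m + 1).factorial : ℝ)))) *
        ∫⁻ x in S, ‖F 0 x‖ₑ ^ 2)
    {p : EuclideanSpace ℝ (Fin d)} (hbox : ∀ x ∈ S, ∀ k, x k ∈ Ioo (p k) (p k + l k))
    (Ψ : EuclideanSpace ℝ (Fin d) ≃ₗ[ℝ] EuclideanSpace ℝ (Fin d)) (hc : 0 < c) (hD : 0 < D)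
    (hdiam : ∀ x ∈ S, ∀ y ∈ S, dist (Ψ x) (Ψ y) ≤ D)
    (hvol : ENNReal.ofReal (c * D ^ d) ≤ volume (Ψ '' (S ∩ ω))) :
    ∫⁻ x in S, ‖F 0 x‖ₑ ^ 2 ≤
      ENNReal.ofReal (1 / 12 * (24 * d * unitBallVolume d / c) ^
        (4 * (Real.log (2 * √κ * h) / Real.log 2) + 1)) * ∫⁻ x in S ∩ ω, ‖F 0 x‖ₑ ^ 2 := by
  have hdp : (0 : ℝ) < d := by exact_mod_cast hd
  have hτ := unitBallVolume_pos d
  set L := Real.log (2 * √κ * h) / Real.log 2 with hL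
  set I := ∫⁻ x in S, ‖F 0 x‖ₑ ^ 2 with hI
  have hsq : ∀ x, ENNReal.ofReal (jetNormSq (fun α => F α x) 0) = ‖F 0 x‖ₑ ^ 2 := by
    intro x
    rw [jetNormSq_zero, ENNReal.ofReal_pow (norm_nonneg _), ofReal_norm]
  rcases eq_or_ne I 0 with hI0 | hI0
  · rw [hI0]; exact zero_le
  obtain ⟨J, hJ0, hJtop, hJ⟩ := exists_volume_image_linearEquiv_eq Ψ
  have hV0 : volume S ≠ 0 := by
    intro h0
    exact hI0 (by rw [hI, Measure.restrict_eq_zero.2 h0, lintegral_zero_measure])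
  obtain ⟨q, hq⟩ : S.Nonempty := nonempty_of_measure_ne_zero hV0
  have hVτ : volume (Ψ '' S) ≤ ENNReal.ofReal (D ^ d * unitBallVolume d) := by
    have h1 : Ψ '' S ⊆ Metric.closedBall (Ψ q) D := by
      rintro _ ⟨x, hx, rfl⟩
      exact hdiam x hx q hq
    refine (measure_mono h1).trans_eq ?_
    rw [Measure.addHaar_closedBall _ _ hD.le, finrank_euclideanSpace_fin, volume_unit_ball_eq d hd,
      ENNReal.ofReal_mul (by positivity)]
  have hVfin : volume S ≠ ∞ := by
    intro htop
    rw [hJ, htop, ENNReal.mul_top hJ0] at hVτ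
    exact absurd hVτ (by simp)
  have hIfin : I ≠ ∞ := by
    have h1 : I ≤ ∫⁻ _ in S, ENNReal.ofReal (K * (4 ^ 0 * (C 0 / ((0 : ℕ).factorial : ℝ)))) := by
      refine setLIntegral_mono measurable_const fun x hx => ?_
      rw [← hsq]
      exact ENNReal.ofReal_le_ofReal (hsup 0 x hx)
    rw [setLIntegral_const] at h1
    exact ne_top_of_le_ne_top (ENNReal.mul_ne_top ENNReal.ofReal_ne_top hVfin) h1
  -- The mean of |F 0|² over `S`.
  set T := (I / volume S).toReal with hT
  have hIVfin : I / volume S ≠ ∞ := ENNReal.div_ne_top hIfin hV0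
  have hTpos : 0 < T := ENNReal.toReal_pos (ENNReal.div_ne_zero.2 ⟨hI0, hVfin⟩) hIVfin
  have hTof : ENNReal.ofReal T = I / volume S := ENNReal.ofReal_toReal hIVfin
  have hTV : ENNReal.ofReal T * volume S = I := by
    rw [hTof, ENNReal.div_mul_cancel hV0 hVfin]
  obtain ⟨y, hy, hyT⟩ : ∃ y ∈ S, T ≤ ‖F 0 y‖ ^ 2 := by
    obtain ⟨y, hy, hle⟩ := exists_setLAverage_le (f := fun x => ‖F 0 x‖ₑ ^ 2) hV0
      hSm.nullMeasurableSet hIfin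
    refine ⟨y, hy, ?_⟩
    rw [setLAverage_eq, ← hI, ← hTof, ← ofReal_norm, ← ENNReal.ofReal_pow (norm_nonneg _)] at hle
    exact (ENNReal.ofReal_le_ofReal_iff (by positivity)).1 hle
  -- Thresholds grow like `4 ^ m` against integrals growing like `2 ^ m`, so Markov's bounds are
  -- summable over all orders, and one `x` serves them all.
  obtain ⟨x, hx, hgood⟩ : ∃ x ∈ S, ∀ m, jetNormSq (fun α => F α x) m ≤
      κ * T * (4 ^ (m + 1) * (C m / (m.factorial : ℝ))) := by
    refine exists_forall_le_of_lintegral_le hV0 hVfin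
      (fun m x => jetNormSq (fun α => F α x) m) (fun m => (continuous_jetNormSq hFc m).measurable)
      (fun m => κ * T * (4 ^ (m + 1) * (C m / (m.factorial : ℝ)))) (fun m => ?_) ?_ fun m => ?_
    · have := hC m
      positivity
    · simp only [hsq]
      rw [← hI, ← hTV]
      gcongr
      norm_num
      nlinarith [mul_le_mul hκ hC0 zero_le_one (by linarith)]
    · refine (hint m).trans (le_of_eq ?_)
      have h3 := hC (m + 1)
      rw [← hTV, ← mul_assoc, ← ENNReal.ofReal_mul (by positivity)]
      congr 2
      have h4 : (4 : ℝ) ^ (m + 1 + 1) = 16 * (2 ^ m * 2 ^ m) := by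
        rw [pow_succ, pow_succ, show (4 : ℝ) = 2 * 2 by norm_num, mul_pow]; ring
      have h5 : (1 / 2 : ℝ) ^ m * 2 ^ m = 1 := by rw [← mul_pow]; norm_num
      rw [h4, pow_add]
      linear_combination (-(5 * κ * T * 2 ^ m * (C (m + 1) / ((m + 1).factorial : ℝ)))) * h5
  have hhalf := hF.two_mul_volume_sublevel_le hd hFc hS hSm hω hl hK hκ hTpos hsum hh hh1 hsup hx hy
    hgood hyT hbox Ψ hc hD hdiam hvol
  set c₀ := (c / (24 * d * unitBallVolume d)) ^ (2 * L) with hc₀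
  have hc₀pos : 0 < c₀ := by positivity
  set Λ : Set (EuclideanSpace ℝ (Fin d)) := {x ∈ S ∩ ω | ‖F 0 x‖ < √T * c₀} with hΛ
  have hΛm : MeasurableSet Λ :=
    (hSm.inter hω).inter (measurableSet_lt (hFc 0).norm.measurable measurable_const)
  set P := volume (S ∩ ω) with hP
  have hPfin : P ≠ ∞ := ne_top_of_le_ne_top hVfin (measure_mono inter_subset_left)
  have hlow : ENNReal.ofReal (T * c₀ ^ 2) * P ≤ 2 * ∫⁻ x in S ∩ ω, ‖F 0 x‖ₑ ^ 2 := by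
    have h6 : P ≤ 2 * volume ((S ∩ ω) \ Λ) := by
      have h7 : P ≤ volume Λ + volume ((S ∩ ω) \ Λ) := by
        rw [hP, measure_add_sdiff hΛm.nullMeasurableSet]
        exact measure_mono subset_union_right
      have h8 : P + P ≤ P + 2 * volume ((S ∩ ω) \ Λ) := by
        calc P + P = 2 * P := (two_mul P).symm
          _ ≤ 2 * (volume Λ + volume ((S ∩ ω) \ Λ)) := by gcongr
          _ = 2 * volume Λ + 2 * volume ((S ∩ ω) \ Λ) := mul_add _ _ _
          _ ≤ _ := by gcongr
      exact (ENNReal.add_le_add_iff_left hPfin).1 h8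
    calc _ ≤ ENNReal.ofReal (T * c₀ ^ 2) * (2 * volume ((S ∩ ω) \ Λ)) := by gcongr
      _ = 2 * ∫⁻ _ in (S ∩ ω) \ Λ, ENNReal.ofReal (T * c₀ ^ 2) := by
          rw [setLIntegral_const]; ring
      _ ≤ 2 * ∫⁻ x in (S ∩ ω) \ Λ, ‖F 0 x‖ₑ ^ 2 := by
          gcongr 2 * ?_
          refine setLIntegral_mono (by
            have := (hFc 0).enorm.measurable
            fun_prop) fun x hx => ?_
          rw [← ofReal_norm, ← ENNReal.ofReal_pow (norm_nonneg _)]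
          refine ENNReal.ofReal_le_ofReal ?_
          have h9 : √T * c₀ ≤ ‖F 0 x‖ := by
            by_contra hlt
            exact hx.2 ⟨hx.1, not_le.1 hlt⟩
          calc T * c₀ ^ 2 = (√T * c₀) ^ 2 := by rw [mul_pow, Real.sq_sqrt hTpos.le]
            _ ≤ _ := by gcongr
      _ ≤ _ := by
          gcongr 2 * ?_
          exact lintegral_mono_set sdiff_subset
  -- The determinant of `Ψ` cancels: `Ψ '' S` lies in a ball of radius `D`, while `Ψ '' (S ∩ ω)` has
  -- volume at least c·D^d.
  have hVP : volume S ≤ ENNReal.ofReal (unitBallVolume d / c) * P := by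
    rw [← ENNReal.mul_le_mul_iff_right hJ0 hJtop, ← hJ]
    refine hVτ.trans ?_
    calc _ = ENNReal.ofReal (unitBallVolume d / c) * ENNReal.ofReal (c * D ^ d) := by
          rw [← ENNReal.ofReal_mul (by positivity)]
          congr 1
          field_simp
      _ ≤ ENNReal.ofReal (unitBallVolume d / c) * volume (Ψ '' (S ∩ ω)) := by gcongr
      _ = _ := by rw [hJ]; ring
  set b := 24 * d * unitBallVolume d / c with hb
  have hbpos : 0 < b := by positivity
  have hcb : c₀ ^ 2 = b ^ (-(4 * L)) := by
    have : c / (24 * d * unitBallVolume d) = b⁻¹ := by rw [hb, inv_div]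
    rw [hc₀, this, ← Real.rpow_natCast, ← Real.rpow_mul (by positivity),
      Real.inv_rpow hbpos.le, Real.rpow_neg hbpos.le]
    congr 2
    push_cast
    ring
  calc I = ENNReal.ofReal T * volume S := hTV.symm
    _ ≤ ENNReal.ofReal T * (ENNReal.ofReal (unitBallVolume d / c) * P) := by gcongr
    _ = ENNReal.ofReal (unitBallVolume d / c * b ^ (4 * L)) *
        (ENNReal.ofReal (T * c₀ ^ 2) * P) := by
        rw [← mul_assoc, ← mul_assoc, ← ENNReal.ofReal_mul hTpos.le,
          ← ENNReal.ofReal_mul (by positivity), hcb, Real.rpow_neg hbpos.le]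
        congr 2
        have : b ^ (4 * L) ≠ 0 := (Real.rpow_pos_of_pos hbpos _).ne'
        field_simp
    _ ≤ ENNReal.ofReal (unitBallVolume d / c * b ^ (4 * L)) *
        (2 * ∫⁻ x in S ∩ ω, ‖F 0 x‖ₑ ^ 2) := by gcongr
    _ = ENNReal.ofReal (2 * (unitBallVolume d / c * b ^ (4 * L))) *
        ∫⁻ x in S ∩ ω, ‖F 0 x‖ₑ ^ 2 := by
        rw [ENNReal.ofReal_mul two_pos.le]
        norm_num
        ring
    _ ≤ _ := by
        gcongr ENNReal.ofReal ?_ * _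
        rw [Real.rpow_add hbpos, Real.rpow_one]
        -- The factor 2τ_d/c is absorbed into one further power of `b`, which uses d ≥ 1 and leaves
        -- 1/12.
        have h10 : 2 * (unitBallVolume d / c) ≤ 1 / 12 * b := by
          have : 1 / 12 * b = 2 * (unitBallVolume d / c) * d := by rw [hb]; ring
          rw [this]
          refine le_mul_of_one_le_right (by positivity) (by exact_mod_cast hd)
        have h11 : 0 < b ^ (4 * L) := Real.rpow_pos_of_pos hbpos _
        nlinarith

/-! ### Weak derivatives and mollification -/

theorem contDiff_partialDeriv {d : ℕ} {φ : EuclideanSpace ℝ (Fin d) → ℝ}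
    (hφ : ContDiff ℝ (⊤ : ℕ∞) φ) (i : Fin d) : ContDiff ℝ (⊤ : ℕ∞) (partialDeriv i φ) := by
  unfold partialDeriv
  exact (hφ.fderiv_right (m := (⊤ : ℕ∞)) (by simp)).clm_apply contDiff_const

theorem contDiff_partialDeriv_iterate {d : ℕ} (i : Fin d) (n : ℕ) :
    ∀ φ : EuclideanSpace ℝ (Fin d) → ℝ, ContDiff ℝ (⊤ : ℕ∞) φ →
      ContDiff ℝ (⊤ : ℕ∞) ((partialDeriv i)^[n] φ) := by
  induction n with
  | zero => exact fun φ hφ => hφ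
  | succ n ih => exact fun φ hφ => ih _ (contDiff_partialDeriv hφ i)

theorem partialDeriv_comm {d : ℕ} {φ : EuclideanSpace ℝ (Fin d) → ℝ}
    (hφ : ContDiff ℝ (⊤ : ℕ∞) φ) (i j : Fin d) :
    partialDeriv i (partialDeriv j φ) = partialDeriv j (partialDeriv i φ) := by
  have hd : ∀ x, DifferentiableAt ℝ (fderiv ℝ φ) x := fun x =>
    (hφ.fderiv_right (m := (⊤ : ℕ∞)) (by simp)).differentiable (by simp) x
  have h1 : ∀ (x u v : EuclideanSpace ℝ (Fin d)),
      fderiv ℝ (fun y => fderiv ℝ φ y v) x u = fderiv ℝ (fderiv ℝ φ) x u v := by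
    intro x u v
    rw [fderiv_clm_apply (hd x) (differentiableAt_const v)]
    simp
  funext x
  have hsymm := (hφ.contDiffAt (x := x)).isSymmSndFDerivAt
    (by rw [minSmoothness_of_isRCLikeNormedField]; exact WithTop.coe_le_coe.2 (le_top : (2 : ℕ∞) ≤ ⊤))
  unfold partialDeriv
  rw [h1, h1]
  exact hsymm _ _

theorem partialDeriv_iterate_comm {d : ℕ} (i j : Fin d) (n : ℕ) :
    ∀ φ : EuclideanSpace ℝ (Fin d) → ℝ, ContDiff ℝ (⊤ : ℕ∞) φ →
      (partialDeriv i)^[n] (partialDeriv j φ) = partialDeriv j ((partialDeriv i)^[n] φ) := by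
  induction n with
  | zero => exact fun φ _ => rfl
  | succ n ih =>
    intro φ hφ
    rw [Function.iterate_succ_apply, Function.iterate_succ_apply, partialDeriv_comm hφ,
      ih _ (contDiff_partialDeriv hφ i)]

/-- `multiDeriv` applies the partial derivatives in a fixed order, so the extra derivative must be
commuted to its own slot. Induction requires arbitrary lists of indices in place of `List.finRange
d`. -/
theorem multiDeriv_partialDeriv {d : ℕ} (α : Fin d → ℕ) (j : Fin d)
    {φ : EuclideanSpace ℝ (Fin d) → ℝ} (hφ : ContDiff ℝ (⊤ : ℕ∞) φ) :
    multiDeriv α (partialDeriv j φ) = multiDeriv (α + Pi.single j 1) φ := by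
  set T : (Fin d → ℕ) → List (Fin d) → (EuclideanSpace ℝ (Fin d) → ℝ) →
    (EuclideanSpace ℝ (Fin d) → ℝ) :=
    fun α s φ => s.foldr (fun i ψ => (partialDeriv i)^[α i] ψ) φ with hT
  have hsm : ∀ s, ContDiff ℝ (⊤ : ℕ∞) (T α s φ) := by
    intro s
    induction s with
    | nil => exact hφ
    | cons i s ih => exact contDiff_partialDeriv_iterate i _ _ ih
  have h1 : ∀ s, T α s (partialDeriv j φ) = partialDeriv j (T α s φ) := by
    intro s
    induction s with
    | nil => rfl
    | cons i s ih =>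
      change (partialDeriv i)^[α i] (T α s (partialDeriv j φ)) =
        partialDeriv j ((partialDeriv i)^[α i] (T α s φ))
      rw [ih, partialDeriv_iterate_comm _ _ _ _ (hsm s)]
  have h2 : ∀ s, j ∉ s → T (α + Pi.single j 1) s φ = T α s φ := by
    intro s
    induction s with
    | nil => exact fun _ => rfl
    | cons i s ih =>
      intro hj
      rw [List.mem_cons, not_or] at hj
      change (partialDeriv i)^[(α + Pi.single j 1 : Fin d → ℕ) i] (T _ s φ) =
        (partialDeriv i)^[α i] (T α s φ)
      rw [ih hj.2, Pi.add_apply, Pi.single_eq_of_ne (Ne.symm hj.1), add_zero]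
  have h3 : ∀ s : List (Fin d), s.Nodup → j ∈ s →
      T (α + Pi.single j 1) s φ = partialDeriv j (T α s φ) := by
    intro s
    induction s with
    | nil => simp
    | cons i s ih =>
      intro hnd hj
      rw [List.nodup_cons] at hnd
      change (partialDeriv i)^[(α + Pi.single j 1 : Fin d → ℕ) i] (T _ s φ) =
        partialDeriv j ((partialDeriv i)^[α i] (T α s φ))
      by_cases hij : j = i
      · subst hij
        rw [h2 s hnd.1, Pi.add_apply, Pi.single_eq_same, Function.iterate_succ_apply']
      · rw [ih hnd.2 ((List.mem_cons.1 hj).resolve_left hij), Pi.add_apply,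
          Pi.single_eq_of_ne (Ne.symm hij), add_zero, partialDeriv_iterate_comm _ _ _ _ (hsm s)]
  exact (h1 _).trans (h3 _ (List.nodup_finRange d) (List.mem_finRange j)).symm

theorem tsupport_partialDeriv_subset {d : ℕ} (i : Fin d) (φ : EuclideanSpace ℝ (Fin d) → ℝ) :
    tsupport (partialDeriv i φ) ⊆ tsupport φ :=
  tsupport_fderiv_apply_subset ℝ _

/-- Consecutive weak derivatives are related by one integration by parts. -/
theorem HasWeakDerivOn.integral_partialDeriv {d : ℕ} {Ω : Set (EuclideanSpace ℝ (Fin d))}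
    {α : Fin d → ℕ} {i : Fin d} {f g g' : EuclideanSpace ℝ (Fin d) → ℂ}
    (hg : HasWeakDerivOn Ω α f g) (hg' : HasWeakDerivOn Ω (α + Pi.single i 1) f g')
    {φ : EuclideanSpace ℝ (Fin d) → ℝ} (hφ : ContDiff ℝ (⊤ : ℕ∞) φ) (hc : HasCompactSupport φ)
    (hs : tsupport φ ⊆ Ω) :
    ∫ x in Ω, partialDeriv i φ x • g x = -∫ x in Ω, φ x • g' x := by
  have h1 := hg.2.2 (partialDeriv i φ) (contDiff_partialDeriv hφ i)
    (hc.mono' ((subset_tsupport _).trans (tsupport_partialDeriv_subset i φ)))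
    ((tsupport_partialDeriv_subset i φ).trans hs)
  have h2 := hg'.2.2 φ hφ hc hs
  rw [multiDeriv_partialDeriv α i hφ, h2] at h1
  have h3 : ∑ k, (α + Pi.single i 1 : Fin d → ℕ) k = ∑ k, α k + 1 := by
    simp [Finset.sum_add_distrib]
  rw [h3, pow_succ, mul_assoc] at h1
  have h4 := mul_left_cancel₀ (pow_ne_zero _ (by norm_num)) h1
  rw [← h4]
  ring

open scoped Convolution in
/-- Convolution with a normalized bump function. -/
def mollify {d : ℕ} (ρ : ContDiffBump (0 : EuclideanSpace ℝ (Fin d)))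
    (g : EuclideanSpace ℝ (Fin d) → ℂ) : EuclideanSpace ℝ (Fin d) → ℂ :=
  ρ.normed volume ⋆[ContinuousLinearMap.lsmul ℝ ℝ, volume] g

theorem mollify_apply {d : ℕ} (ρ : ContDiffBump (0 : EuclideanSpace ℝ (Fin d)))
    (g : EuclideanSpace ℝ (Fin d) → ℂ) (x : EuclideanSpace ℝ (Fin d)) :
    mollify ρ g x = ∫ t, ρ.normed volume (x - t) • g t :=
  convolution_lsmul_swap

theorem continuous_mollify {d : ℕ} (ρ : ContDiffBump (0 : EuclideanSpace ℝ (Fin d)))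
    {g : EuclideanSpace ℝ (Fin d) → ℂ} (hg : LocallyIntegrable g) : Continuous (mollify ρ g) :=
  ρ.hasCompactSupport_normed.continuous_convolution_left _ ρ.continuous_normed hg

/-- The derivative falls on the bump function; the explicit integral is the form to which
integration by parts applies. -/
theorem hasFDerivAt_mollify {d : ℕ} (ρ : ContDiffBump (0 : EuclideanSpace ℝ (Fin d)))
    {g : EuclideanSpace ℝ (Fin d) → ℂ} (hg : LocallyIntegrable g)
    (x : EuclideanSpace ℝ (Fin d)) :
    ∃ F' : EuclideanSpace ℝ (Fin d) →L[ℝ] ℂ, HasFDerivAt (mollify ρ g) F' x ∧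
      ∀ v, F' v = ∫ t, fderiv ℝ (ρ.normed volume) (x - t) v • g t := by
  have hd : ContDiff ℝ 1 (ρ.normed (volume : Measure (EuclideanSpace ℝ (Fin d)))) :=
    ρ.contDiff_normed (n := 1)
  refine ⟨_, ρ.hasCompactSupport_normed.hasFDerivAt_convolution_left
    (ContinuousLinearMap.lsmul ℝ ℝ) hd hg x, fun v => ?_⟩
  have hex := (ρ.hasCompactSupport_normed (μ := volume)).fderiv ℝ |>.convolutionExists_left
    (ContinuousLinearMap.precompL (EuclideanSpace ℝ (Fin d))
      (ContinuousLinearMap.lsmul ℝ ℝ : ℝ →L[ℝ] ℂ →L[ℝ] ℂ)) (hd.continuous_fderiv one_ne_zero) hg x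
  rw [convolution_eq_swap, ContinuousLinearMap.integral_apply hex.integrable_swap]
  rfl

/-- Derivatives of mollifications are mollifications of weak derivatives. -/
theorem hasFDerivAt_mollify_indicator {d : ℕ} {Q Ω : Set (EuclideanSpace ℝ (Fin d))}
    (hQΩ : Q ⊆ Ω) (hΩ : MeasurableSet Ω)
    {α : Fin d → ℕ} {i : Fin d} {f g g' : EuclideanSpace ℝ (Fin d) → ℂ}
    (hg : HasWeakDerivOn Ω α f g) (hg' : HasWeakDerivOn Ω (α + Pi.single i 1) f g')
    (ρ : ContDiffBump (0 : EuclideanSpace ℝ (Fin d))) {x : EuclideanSpace ℝ (Fin d)}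
    (hx : Metric.closedBall x ρ.rOut ⊆ Q) :
    ∫ t, fderiv ℝ (ρ.normed volume) (x - t) (EuclideanSpace.single i 1) • Q.indicator g t =
      mollify ρ (Q.indicator g') x := by
  set φ : EuclideanSpace ℝ (Fin d) → ℝ := fun t => ρ.normed volume (x - t) with hφ
  have hφs : ContDiff ℝ (⊤ : ℕ∞) φ :=
    (ρ.contDiff_normed (n := (⊤ : ℕ∞))).comp (contDiff_const.sub contDiff_id)
  have hsupp : tsupport φ ⊆ Metric.closedBall x ρ.rOut := by
    refine closure_minimal (fun t ht => ?_) Metric.isClosed_closedBall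
    have h1 : x - t ∈ Function.support (ρ.normed volume) := ht
    rw [ρ.support_normed_eq, mem_ball_zero_iff] at h1
    rw [Metric.mem_closedBall, dist_comm, dist_eq_norm]
    exact h1.le
  have hφc : HasCompactSupport φ :=
    (isCompact_closedBall x ρ.rOut).of_isClosed_subset (isClosed_tsupport φ) hsupp
  have hpart : ∀ t, partialDeriv i φ t =
      -fderiv ℝ (ρ.normed volume) (x - t) (EuclideanSpace.single i 1) := by
    intro t
    have h1 : HasFDerivAt (ρ.normed (volume : Measure (EuclideanSpace ℝ (Fin d))))
        (fderiv ℝ (ρ.normed volume) (x - t)) (x - t) :=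
      ((ρ.contDiff_normed (n := 1)).differentiable one_ne_zero _).hasFDerivAt
    have h2 := (h1.comp t ((hasFDerivAt_id t).const_sub x)).fderiv
    unfold partialDeriv
    change fderiv ℝ ((ρ.normed volume) ∘ fun t => x - t) t _ = _
    rw [h2]
    simp
  have hibp := hg.integral_partialDeriv hg' hφs hφc (hsupp.trans (hx.trans hQΩ))
  have hset : ∀ (u : EuclideanSpace ℝ (Fin d) → ℝ) (w : EuclideanSpace ℝ (Fin d) → ℂ),
      tsupport u ⊆ tsupport φ → ∫ t in Ω, u t • w t = ∫ t, u t • Q.indicator w t := by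
    intro u w hu
    rw [← integral_indicator hΩ]
    congr 1
    funext t
    by_cases htQ : t ∈ Q
    · rw [indicator_of_mem (hQΩ htQ), indicator_of_mem htQ]
    · have : u t = 0 := image_eq_zero_of_notMem_tsupport fun h => htQ (hx (hsupp (hu h)))
      rw [indicator_of_notMem htQ, smul_zero]
      exact indicator_apply_eq_zero.2 fun _ => by rw [this, zero_smul]
  rw [hset _ _ (tsupport_partialDeriv_subset i φ), hset _ _ le_rfl] at hibp
  simp only [hpart, neg_smul, integral_neg] at hibp
  rw [mollify_apply]
  exact neg_injective hibp

theorem lintegral_normed {d : ℕ} (ρ : ContDiffBump (0 : EuclideanSpace ℝ (Fin d))) :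
    ∫⁻ x, ENNReal.ofReal (ρ.normed volume x) = 1 := by
  rw [← ofReal_integral_eq_lintegral_ofReal ρ.integrable_normed
    (Filter.Eventually.of_forall fun x => ρ.nonneg_normed x), ρ.integral_normed, ENNReal.ofReal_one]

/-- Jensen's inequality for mollifications. -/
theorem enorm_mollify_sq_le {d : ℕ} (ρ : ContDiffBump (0 : EuclideanSpace ℝ (Fin d)))
    {g : EuclideanSpace ℝ (Fin d) → ℂ} (hg : AEStronglyMeasurable g volume)
    (x : EuclideanSpace ℝ (Fin d)) :
    ‖mollify ρ g x‖ₑ ^ 2 ≤ ∫⁻ t, ENNReal.ofReal (ρ.normed volume (x - t)) * ‖g t‖ₑ ^ 2 := by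
  set k : EuclideanSpace ℝ (Fin d) → ℝ≥0∞ := fun t => ENNReal.ofReal (ρ.normed volume (x - t))
  have hk : Measurable k :=
    (ρ.continuous_normed.comp (continuous_const.sub continuous_id)).measurable.ennreal_ofReal
  have hk1 : ∫⁻ t, k t = 1 := by
    rw [← lintegral_normed ρ]
    exact lintegral_sub_left_eq_self (fun t => ENNReal.ofReal (ρ.normed volume t)) x
  have h1 : ‖mollify ρ g x‖ₑ ≤ ∫⁻ t, k t * ‖g t‖ₑ := by
    rw [mollify_apply]
    refine (enorm_integral_le_lintegral_enorm _).trans_eq ?_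
    congr 1
    funext t
    rw [enorm_smul, Real.enorm_of_nonneg (ρ.nonneg_normed _)]
  have h2 : ∫⁻ t, k t * ‖g t‖ₑ ≤ (∫⁻ t, k t * ‖g t‖ₑ ^ 2) ^ (1 / 2 : ℝ) := by
    have hh := ENNReal.lintegral_mul_le_Lp_mul_Lq volume Real.HolderConjugate.two_two
      (f := fun t => k t ^ (1 / 2 : ℝ)) (g := fun t => k t ^ (1 / 2 : ℝ) * ‖g t‖ₑ)
      (hk.pow_const _).aemeasurable ((hk.pow_const _).aemeasurable.mul hg.enorm)
    have e1 : ∀ t, (k t ^ (1 / 2 : ℝ)) ^ (2 : ℝ) = k t := by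
      intro t
      rw [← ENNReal.rpow_mul]; norm_num
    have e2 : ∀ t, k t ^ (1 / 2 : ℝ) * (k t ^ (1 / 2 : ℝ) * ‖g t‖ₑ) = k t * ‖g t‖ₑ := by
      intro t
      have := e1 t
      rw [ENNReal.rpow_two, sq] at this
      rw [← mul_assoc, this]
    have e3 : ∀ t, (k t ^ (1 / 2 : ℝ) * ‖g t‖ₑ) ^ (2 : ℝ) = k t * ‖g t‖ₑ ^ 2 := by
      intro t
      rw [ENNReal.mul_rpow_of_nonneg _ _ (by norm_num), e1, ENNReal.rpow_two]
    simp only [Pi.mul_apply, e1, e2, e3, hk1, ENNReal.one_rpow, one_mul] at hh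
    exact hh
  calc ‖mollify ρ g x‖ₑ ^ 2 ≤ ((∫⁻ t, k t * ‖g t‖ₑ ^ 2) ^ (1 / 2 : ℝ)) ^ 2 := by
        gcongr
        exact h1.trans h2
    _ = _ := by
        rw [← ENNReal.rpow_two, ← ENNReal.rpow_mul, div_mul_cancel₀ _ two_ne_zero, ENNReal.rpow_one]

/-- The constant blows up with the scale, which is harmless: it serves only to make the Taylor
series converge and never enters the final estimate. -/
theorem enorm_mollify_sq_le_mul {d : ℕ} (ρ : ContDiffBump (0 : EuclideanSpace ℝ (Fin d)))
    {g : EuclideanSpace ℝ (Fin d) → ℂ} (hg : AEStronglyMeasurable g volume)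
    (x : EuclideanSpace ℝ (Fin d)) :
    ‖mollify ρ g x‖ₑ ^ 2 ≤
      ENNReal.ofReal (1 / volume.real (Metric.closedBall (0 : EuclideanSpace ℝ (Fin d)) ρ.rIn)) *
        ∫⁻ t, ‖g t‖ₑ ^ 2 := by
  refine (enorm_mollify_sq_le ρ hg x).trans ?_
  rw [← lintegral_const_mul'' _ (hg.enorm.pow_const 2)]
  gcongr with t
  exact ρ.normed_le_div_measure_closedBall_rIn _ _

/-- Jensen followed by Tonelli. That the constant is 1 lets the derivative bounds on a good cell
pass to the mollifications unchanged. -/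
theorem lintegral_enorm_mollify_sq_le {d : ℕ} (ρ : ContDiffBump (0 : EuclideanSpace ℝ (Fin d)))
    {g : EuclideanSpace ℝ (Fin d) → ℂ} (hg : AEStronglyMeasurable g volume) :
    ∫⁻ x, ‖mollify ρ g x‖ₑ ^ 2 ≤ ∫⁻ x, ‖g x‖ₑ ^ 2 := by
  calc ∫⁻ x, ‖mollify ρ g x‖ₑ ^ 2
      ≤ ∫⁻ x, ∫⁻ t, ENNReal.ofReal (ρ.normed volume (x - t)) * ‖g t‖ₑ ^ 2 :=
        lintegral_mono fun x => enorm_mollify_sq_le ρ hg x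
    _ = ∫⁻ t, ∫⁻ x, ENNReal.ofReal (ρ.normed volume (x - t)) * ‖g t‖ₑ ^ 2 := by
        refine lintegral_lintegral_swap ?_
        have h1 : Measurable fun p : EuclideanSpace ℝ (Fin d) × EuclideanSpace ℝ (Fin d) =>
            ENNReal.ofReal (ρ.normed volume (p.1 - p.2)) :=
          (ρ.continuous_normed.comp (continuous_fst.sub continuous_snd)).measurable.ennreal_ofReal
        exact h1.aemeasurable.mul (hg.comp_snd.enorm.pow_const 2)
    _ = ∫⁻ t, ‖g t‖ₑ ^ 2 := by
        congr 1
        funext t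
        have h2 : Measurable fun x => ENNReal.ofReal (ρ.normed volume (x - t)) :=
          (ρ.continuous_normed.comp
            (continuous_id.sub continuous_const)).measurable.ennreal_ofReal
        rw [lintegral_mul_const _ h2,
          lintegral_sub_right_eq_self (fun x => ENNReal.ofReal (ρ.normed volume x)) t,
          lintegral_normed, one_mul]

theorem l2NormSq_eq_lintegral {d : ℕ} (S : Set (EuclideanSpace ℝ (Fin d)))
    (g : EuclideanSpace ℝ (Fin d) → ℂ) : l2NormSq S g = ∫⁻ x in S, ‖g x‖ₑ ^ 2 := by
  have h := eLpNorm_nnreal_pow_eq_lintegral (μ := volume.restrict S) (f := g) (p := 2) two_ne_zero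
  simp only [NNReal.coe_ofNat, ENNReal.rpow_two, ENNReal.coe_ofNat] at h
  exact h

theorem lintegral_enorm_indicator_sq {d : ℕ} {S : Set (EuclideanSpace ℝ (Fin d))}
    (hS : MeasurableSet S) (g : EuclideanSpace ℝ (Fin d) → ℂ) :
    ∫⁻ x, ‖S.indicator g x‖ₑ ^ 2 = l2NormSq S g := by
  rw [l2NormSq_eq_lintegral, ← lintegral_indicator hS]
  congr 1
  funext x
  by_cases hx : x ∈ S <;> simp [hx]

theorem ofReal_jetNormSq {d : ℕ} (c : (Fin d → ℕ) → ℂ) (m : ℕ) :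
    ENNReal.ofReal (jetNormSq c m) =
      ∑ α ∈ Finset.piAntidiag (Finset.univ : Finset (Fin d)) m,
        ENNReal.ofReal (1 / multiFactorial α) * ‖c α‖ₑ ^ 2 := by
  unfold jetNormSq
  rw [ENNReal.ofReal_sum_of_nonneg
    fun α _ => div_nonneg (sq_nonneg _) (multiFactorial_pos α).le]
  refine Finset.sum_congr rfl fun α _ => ?_
  rw [← ofReal_norm, ← ENNReal.ofReal_pow (norm_nonneg _),
    ← ENNReal.ofReal_mul (one_div_nonneg.2 (multiFactorial_pos α).le)]
  congr 1
  ring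

/-- The points whose distance to the complement of `Q` exceeds `ε`. -/
def innerSet {d : ℕ} (Q : Set (EuclideanSpace ℝ (Fin d))) (ε : ℝ) :
    Set (EuclideanSpace ℝ (Fin d)) := {x | Metric.closedBall x ε ⊆ Q}

theorem innerSet_subset {d : ℕ} (Q : Set (EuclideanSpace ℝ (Fin d))) {ε : ℝ} (hε : 0 ≤ ε) :
    innerSet Q ε ⊆ Q := fun _ hx => hx (Metric.mem_closedBall_self hε)

-- The complement is the sum of a closed set and a compact ball, hence closed.
open scoped Pointwise in
theorem isOpen_innerSet {d : ℕ} {Q : Set (EuclideanSpace ℝ (Fin d))} (hQ : IsOpen Q) (ε : ℝ) :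
    IsOpen (innerSet Q ε) := by
  have h1 : IsClosed (Qᶜ + Metric.closedBall (0 : EuclideanSpace ℝ (Fin d)) ε) :=
    hQ.isClosed_compl.add_right_of_isCompact (isCompact_closedBall _ _)
  have h2 : innerSet Q ε = (Qᶜ + Metric.closedBall (0 : EuclideanSpace ℝ (Fin d)) ε)ᶜ := by
    ext x
    simp only [innerSet, mem_ofPred_eq, mem_compl_iff, mem_add, not_exists, not_and]
    constructor
    · intro h q hq e he hx
      refine hq (h ?_)
      rw [← hx]
      simpa [Metric.mem_closedBall, dist_eq_norm] using he
    · intro h q hq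
      by_contra hn
      refine h q hn (x - q) ?_ (by abel)
      rw [Metric.mem_closedBall, dist_comm, dist_eq_norm] at hq
      simpa using hq
  rw [h2]
  exact h1.isOpen_compl

theorem convex_innerSet {d : ℕ} {Q : Set (EuclideanSpace ℝ (Fin d))} (hQ : Convex ℝ Q) (ε : ℝ) :
    Convex ℝ (innerSet Q ε) := by
  intro x hx y hy a b ha hb hab z hz
  set e := z - (a • x + b • y) with he
  have hen : ‖e‖ ≤ ε := by simpa [Metric.mem_closedBall, dist_eq_norm] using hz
  have h1 : x + e ∈ Q := hx (by simpa [Metric.mem_closedBall, dist_eq_norm] using hen)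
  have h2 : y + e ∈ Q := hy (by simpa [Metric.mem_closedBall, dist_eq_norm] using hen)
  have h3 := hQ h1 h2 ha hb hab
  have h4 : a • (x + e) + b • (y + e) = z := by
    rw [smul_add, smul_add, add_add_add_comm, ← add_smul, hab, one_smul, he]
    abel
  rwa [h4] at h3

theorem eventually_mem_innerSet {d : ℕ} {Q : Set (EuclideanSpace ℝ (Fin d))} (hQ : IsOpen Q)
    {x : EuclideanSpace ℝ (Fin d)} (hx : x ∈ Q) :
    ∀ᶠ n : ℕ in Filter.atTop, x ∈ innerSet Q (1 / ((n : ℝ) + 1)) := by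
  obtain ⟨r, hr, hrQ⟩ := Metric.isOpen_iff.1 hQ x hx
  filter_upwards [tendsto_one_div_add_atTop_nhds_zero_nat.eventually_lt_const hr] with n hn
  exact (Metric.closedBall_subset_ball hn).trans hrQ

theorem lintegral_le_liminf_of_ae_tendsto {d : ℕ} {H : ℕ → EuclideanSpace ℝ (Fin d) → ℝ≥0∞}
    {G : EuclideanSpace ℝ (Fin d) → ℝ≥0∞} (hH : ∀ n, Measurable (H n))
    (h : ∀ᵐ x, Filter.Tendsto (fun n => H n x) Filter.atTop (nhds (G x))) :
    ∫⁻ x, G x ≤ Filter.liminf (fun n => ∫⁻ x, H n x) Filter.atTop := by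
  have h1 : ∫⁻ x, G x = ∫⁻ x, Filter.liminf (fun n => H n x) Filter.atTop :=
    lintegral_congr_ae (h.mono fun x hx => hx.liminf_eq.symm)
  rw [h1]
  exact lintegral_liminf_le hH

/-- The mollifier at scale `1 / (n + 1)`. -/
def mollifier (d n : ℕ) : ContDiffBump (0 : EuclideanSpace ℝ (Fin d)) where
  rIn := 1 / ((n : ℝ) + 1) / 2
  rOut := 1 / ((n : ℝ) + 1)
  rIn_pos := by positivity
  rIn_lt_rOut := half_lt_self (by positivity)

theorem ae_tendsto_mollify {d : ℕ} {g : EuclideanSpace ℝ (Fin d) → ℂ}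
    (hg : LocallyIntegrable g) :
    ∀ᵐ x, Filter.Tendsto (fun n => mollify (mollifier d n) g x) Filter.atTop (nhds (g x)) :=
  ContDiffBump.ae_convolution_tendsto_right_of_locallyIntegrable (K := 2)
    (φ := mollifier d) tendsto_one_div_add_atTop_nhds_zero_nat
    (Filter.Eventually.of_forall fun n => by
      change 1 / ((n : ℝ) + 1) ≤ 2 * (1 / ((n : ℝ) + 1) / 2)
      linarith) hg

theorem tendsto_volume_image_innerSet {d : ℕ} {Q : Set (EuclideanSpace ℝ (Fin d))}
    (hQ : IsOpen Q) (ω : Set (EuclideanSpace ℝ (Fin d)))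
    (Ψ : EuclideanSpace ℝ (Fin d) ≃ₗ[ℝ] EuclideanSpace ℝ (Fin d)) :
    Filter.Tendsto (fun n : ℕ => volume (Ψ '' (innerSet Q (1 / ((n : ℝ) + 1)) ∩ ω)))
      Filter.atTop (nhds (volume (Ψ '' (Q ∩ ω)))) := by
  have h1 : Ψ '' (Q ∩ ω) = ⋃ n : ℕ, Ψ '' (innerSet Q (1 / ((n : ℝ) + 1)) ∩ ω) := by
    rw [← image_iUnion, ← iUnion_inter]
    congr 2
    ext x
    rw [mem_iUnion]
    constructor
    · exact fun hx => (eventually_mem_innerSet hQ hx).exists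
    · rintro ⟨n, hn⟩
      exact innerSet_subset Q (by positivity) hn
  rw [h1]
  refine tendsto_measure_iUnion_atTop fun m n hmn => ?_
  refine image_mono (inter_subset_inter_left _ fun x hx => ?_)
  refine (Metric.closedBall_subset_closedBall ?_).trans hx
  gcongr

/-! ### The local estimate on a good cell, by passing to the limit in the mollification -/

/-- The local estimate on a convex set on which the derivatives of `f` obey Bernstein-type
bounds. -/
theorem l2NormSq_le_of_bernstein {d : ℕ} (hd : 1 ≤ d) {Ω Q ω : Set (EuclideanSpace ℝ (Fin d))}
    (hΩ : MeasurableSet Ω) (hQΩ : Q ⊆ Ω) (hQo : IsOpen Q) (hQc : Convex ℝ Q)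
    (hQb : Bornology.IsBounded Q) (hω : MeasurableSet ω)
    {f : EuclideanSpace ℝ (Fin d) → ℂ} {w : (Fin d → ℕ) → EuclideanSpace ℝ (Fin d) → ℂ}
    (hw : ∀ α, HasWeakDerivOn Ω α f (w α)) (hw2 : ∀ α, MemLp (w α) 2 (volume.restrict Q))
    {C : ℕ → ℝ} {l : Fin d → ℝ} {κ h c D : ℝ} (hC : ∀ m, 0 < C m)
    (hC0 : 1 ≤ C 0) (hl : ∀ k, 0 < l k) (hκ : 1 ≤ κ)
    (hsum : Summable fun m : ℕ => √(C m) * ((10 * ∑ k, l k) ^ m / (m.factorial : ℝ)))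
    (hh : h = ∑' m : ℕ, √(C m) * ((10 * ∑ k, l k) ^ m / (m.factorial : ℝ))) (hh1 : 1 ≤ h)
    (hgood : ∀ m, ∑ α ∈ Finset.piAntidiag (Finset.univ : Finset (Fin d)) (m + 1),
      ENNReal.ofReal (1 / multiFactorial α) * l2NormSq Q (w α) ≤
        ENNReal.ofReal (2 ^ (m + 2) * κ * (C (m + 1) / ((m + 1).factorial : ℝ))) *
          l2NormSq Q (w 0))
    {p : EuclideanSpace ℝ (Fin d)} (hbox : ∀ x ∈ Q, ∀ k, x k ∈ Ioo (p k) (p k + l k))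
    (Ψ : EuclideanSpace ℝ (Fin d) ≃ₗ[ℝ] EuclideanSpace ℝ (Fin d)) (hc : 0 < c) (hD : 0 < D)
    (hdiam : ∀ x ∈ Q, ∀ y ∈ Q, dist (Ψ x) (Ψ y) ≤ D)
    (hvol : ENNReal.ofReal (c * D ^ d) < volume (Ψ '' (Q ∩ ω))) :
    l2NormSq Q (w 0) ≤
      ENNReal.ofReal (1 / 12 * (24 * d * unitBallVolume d / c) ^
        (4 * (Real.log (2 * √κ * h) / Real.log 2) + 1)) * l2NormSq (Q ∩ ω) (w 0) := by
  set B := ENNReal.ofReal (1 / 12 * (24 * d * unitBallVolume d / c) ^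
        (4 * (Real.log (2 * √κ * h) / Real.log 2) + 1)) with hB
  set I := l2NormSq Q (w 0) with hI
  rcases eq_or_ne I 0 with hI0 | hI0
  · rw [hI0]; exact zero_le
  have hIfin : I ≠ ∞ := ENNReal.pow_ne_top (hw2 0).2.ne
  have hQm := hQo.measurableSet
  set u : (Fin d → ℕ) → EuclideanSpace ℝ (Fin d) → ℂ := fun α => Q.indicator (w α) with hu
  have hum : ∀ α, AEStronglyMeasurable (u α) volume := fun α =>
    (aestronglyMeasurable_indicator_iff hQm).2 (hw2 α).1
  have huloc : ∀ α, LocallyIntegrable (u α) := by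
    intro α
    have : IsFiniteMeasure (volume.restrict Q) := ⟨by
      rw [Measure.restrict_apply_univ]; exact hQb.measure_lt_top⟩
    exact ((integrable_indicator_iff hQm).2
      ((hw2 α).integrable (by norm_num))).locallyIntegrable
  have hul2 : ∀ α, ∫⁻ x, ‖u α x‖ₑ ^ 2 = l2NormSq Q (w α) := fun α =>
    lintegral_enorm_indicator_sq hQm (w α)
  set ε : ℕ → ℝ := fun n => 1 / ((n : ℝ) + 1) with hε
  have hε0 : ∀ n, 0 ≤ ε n := fun n => by positivity
  set S : ℕ → Set (EuclideanSpace ℝ (Fin d)) := fun n => innerSet Q (ε n) with hS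
  have hSQ : ∀ n, S n ⊆ Q := fun n => innerSet_subset Q (hε0 n)
  have hSm : ∀ n, MeasurableSet (S n) := fun n => (isOpen_innerSet hQo _).measurableSet
  set F : ℕ → (Fin d → ℕ) → EuclideanSpace ℝ (Fin d) → ℂ :=
    fun n α => mollify (mollifier d n) (u α) with hF
  have hFc : ∀ n α, Continuous (F n α) := fun n α => continuous_mollify _ (huloc α)
  have hjet : ∀ n, IsJetOn (F n) (S n) := by
    intro n α x hx
    obtain ⟨F', hF', hv⟩ := hasFDerivAt_mollify (mollifier d n) (huloc α) x
    refine ⟨F', hF', fun i => ?_⟩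
    rw [hv]
    exact hasFDerivAt_mollify_indicator hQΩ hΩ (hw α) (hw _) _ hx
  have hall : ∀ m, ∑ α ∈ Finset.piAntidiag (Finset.univ : Finset (Fin d)) m,
      ENNReal.ofReal (1 / multiFactorial α) * l2NormSq Q (w α) ≤
        ENNReal.ofReal (2 ^ (m + 1) * κ * (C m / (m.factorial : ℝ))) * I := by
    intro m
    cases m with
    -- Order 0 is not part of goodness; it holds because κ ≥ 1 and `C 0 ≥ 1`.
    | succ m => exact hgood m
    | zero =>
      have h1 : (1 : ℝ≥0∞) ≤ ENNReal.ofReal (2 ^ (0 + 1) * κ * (C 0 / ((0 : ℕ).factorial : ℝ))) := by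
        rw [ENNReal.one_le_ofReal]
        norm_num
        nlinarith
      simpa [multiFactorial] using mul_le_mul_left h1 I
  have hsup : ∀ n, ∃ K, 0 ≤ K ∧ ∀ m, ∀ y ∈ S n,
      jetNormSq (fun α => F n α y) m ≤ K * (4 ^ m * (C m / (m.factorial : ℝ))) := by
    intro n
    set M := 1 / volume.real (Metric.closedBall (0 : EuclideanSpace ℝ (Fin d))
      (mollifier d n).rIn) with hM
    have hM0 : 0 ≤ M := by positivity
    refine ⟨M * (2 * κ) * I.toReal, by positivity, fun m y _ => ?_⟩
    have hCm := hC m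
    have h1 : ENNReal.ofReal (jetNormSq (fun α => F n α y) m) ≤
        ENNReal.ofReal (M * (2 ^ (m + 1) * κ * (C m / (m.factorial : ℝ))) * I.toReal) := by
      rw [ofReal_jetNormSq]
      calc _ ≤ ∑ α ∈ Finset.piAntidiag (Finset.univ : Finset (Fin d)) m,
            ENNReal.ofReal (1 / multiFactorial α) * (ENNReal.ofReal M * l2NormSq Q (w α)) := by
            gcongr with α _
            rw [← hul2]
            exact enorm_mollify_sq_le_mul _ (hum α) y
        _ = ENNReal.ofReal M * ∑ α ∈ Finset.piAntidiag (Finset.univ : Finset (Fin d)) m,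
            ENNReal.ofReal (1 / multiFactorial α) * l2NormSq Q (w α) := by
            rw [Finset.mul_sum]
            refine Finset.sum_congr rfl fun α _ => ?_
            ring
        _ ≤ ENNReal.ofReal M *
            (ENNReal.ofReal (2 ^ (m + 1) * κ * (C m / (m.factorial : ℝ))) * I) := by
            gcongr
            exact hall m
        _ = _ := by
            rw [ENNReal.ofReal_mul (p := M * _) (by positivity), ENNReal.ofReal_mul hM0,
              ENNReal.ofReal_toReal hIfin, ← mul_assoc]
    refine ((ENNReal.ofReal_le_ofReal_iff (by positivity)).1 h1).trans ?_
    have h2 : (2 : ℝ) ^ (m + 1) ≤ 2 * 4 ^ m := by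
      rw [pow_succ, mul_comm]
      gcongr
      norm_num
    calc _ ≤ M * (2 * 4 ^ m * κ * (C m / (m.factorial : ℝ))) * I.toReal := by gcongr
      _ = _ := by ring
  set a : ℕ → EuclideanSpace ℝ (Fin d) → ℝ≥0∞ := fun n x => ‖F n 0 x‖ₑ ^ 2 with ha
  have ham : ∀ n, Measurable (a n) := fun n => (hFc n 0).enorm.measurable.pow_const 2
  have hconv : ∀ᵐ x, Filter.Tendsto (fun n => a n x) Filter.atTop (nhds (‖u 0 x‖ₑ ^ 2)) := by
    filter_upwards [ae_tendsto_mollify (huloc 0)] with x hx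
    exact (((ENNReal.continuous_pow 2).comp continuous_enorm).tendsto _).comp hx
  have hind : ∀ᵐ x, Filter.Tendsto (fun n => (S n).indicator (a n) x) Filter.atTop
      (nhds (‖u 0 x‖ₑ ^ 2)) := by
    filter_upwards [hconv] with x hx
    by_cases hxQ : x ∈ Q
    · refine hx.congr' ?_
      filter_upwards [eventually_mem_innerSet hQo hxQ] with n hn
      rw [indicator_of_mem hn]
    · have h1 : ∀ n, (S n).indicator (a n) x = 0 := fun n =>
        indicator_of_notMem (fun hx => hxQ (hSQ n hx)) _
      simp only [h1, hu, indicator_of_notMem hxQ]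
      simp
  -- For large `n` the mollification keeps 4/5 of the mass on the shrunken cell. The reciprocal 5/4
  -- is affordable, since the exceptional sets then fill 7/8 < 1 of it.
  have hlow : ∀ᶠ n in Filter.atTop, I ≤ ENNReal.ofReal (5 / 4) * ∫⁻ x in S n, a n x := by
    have h1 := lintegral_le_liminf_of_ae_tendsto (fun n => (ham n).indicator (hSm n)) hind
    rw [hul2 0, ← hI] at h1
    have h2 : ENNReal.ofReal (4 / 5) * I < I := by
      conv_rhs => rw [← one_mul I]
      refine ENNReal.mul_lt_mul_left hI0 hIfin ?_
      rw [ENNReal.ofReal_lt_one]; norm_num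
    filter_upwards [Filter.eventually_lt_of_lt_liminf (h2.trans_le h1)] with n hn
    rw [lintegral_indicator (hSm n)] at hn
    calc I = ENNReal.ofReal (5 / 4) * (ENNReal.ofReal (4 / 5) * I) := by
          rw [← mul_assoc, ← ENNReal.ofReal_mul (by norm_num)]; norm_num
      _ ≤ _ := by gcongr
  have hvol' : ∀ᶠ n in Filter.atTop, ENNReal.ofReal (c * D ^ d) < volume (Ψ '' (S n ∩ ω)) :=
    (tendsto_volume_image_innerSet hQo ω Ψ).eventually_const_lt hvol
  have hlocal : ∀ᶠ n in Filter.atTop, ∫⁻ x in S n, a n x ≤ B * ∫⁻ x in S n ∩ ω, a n x := by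
    filter_upwards [hlow, hvol'] with n hn1 hn2
    obtain ⟨K, hK, hKsup⟩ := hsup n
    refine (hjet n).lintegral_enorm_sq_le hd (hFc n) (convex_innerSet hQc _) (hSm n) hω hC hC0 hl
      hK hκ hsum hh hh1 hKsup (fun m => ?_) (fun x hx => hbox x (hSQ n hx)) Ψ hc hD
      (fun x hx y hy => hdiam x (hSQ n hx) y (hSQ n hy)) hn2.le
    have hCm := hC (m + 1)
    calc ∫⁻ x in S n, ENNReal.ofReal (jetNormSq (fun α => F n α x) (m + 1))
        ≤ ∫⁻ x, ENNReal.ofReal (jetNormSq (fun α => F n α x) (m + 1)) := setLIntegral_le_lintegral _ _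
      _ = ∑ α ∈ Finset.piAntidiag (Finset.univ : Finset (Fin d)) (m + 1),
            ENNReal.ofReal (1 / multiFactorial α) * ∫⁻ x, ‖F n α x‖ₑ ^ 2 := by
          simp only [ofReal_jetNormSq]
          rw [lintegral_finsetSum _ fun α _ =>
            ((hFc n α).enorm.measurable.pow_const 2).const_mul _]
          refine Finset.sum_congr rfl fun α _ => ?_
          rw [lintegral_const_mul _ ((hFc n α).enorm.measurable.pow_const 2)]
      _ ≤ ∑ α ∈ Finset.piAntidiag (Finset.univ : Finset (Fin d)) (m + 1),
            ENNReal.ofReal (1 / multiFactorial α) * l2NormSq Q (w α) := by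
          gcongr with α _
          rw [← hul2]
          exact lintegral_enorm_mollify_sq_le _ (hum α)
      _ ≤ ENNReal.ofReal (2 ^ (m + 2) * κ * (C (m + 1) / ((m + 1).factorial : ℝ))) *
            (ENNReal.ofReal (5 / 4) * ∫⁻ x in S n, a n x) := (hgood m).trans (by gcongr)
      _ = _ := by
          rw [← mul_assoc, ← ENNReal.ofReal_mul (by positivity), mul_comm _ (5 / 4 : ℝ)]
  set Z := Q ∩ ω with hZ
  have hZm : MeasurableSet Z := hQm.inter hω
  -- Adding the integral over `Zᶜ` to both sides turns the right side into `B` times a full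
  -- integral, which contractivity bounds by `B * I`. Fatou then treats the left side, and the `Zᶜ`
  -- part is cancelled in the limit; no L² convergence is needed.
  have hupper : ∀ᶠ n in Filter.atTop,
      ∫⁻ x, ((S n).indicator (a n) x + B * Zᶜ.indicator (a n) x) ≤ B * I := by
    filter_upwards [hlocal] with n hn
    rw [lintegral_add_left ((ham n).indicator (hSm n)),
      lintegral_const_mul _ ((ham n).indicator hZm.compl), lintegral_indicator (hSm n),
      lintegral_indicator hZm.compl]
    calc _ ≤ B * (∫⁻ x in Z, a n x) + B * ∫⁻ x in Zᶜ, a n x := by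
          gcongr
          refine hn.trans ?_
          gcongr B * ?_
          exact lintegral_mono_set (inter_subset_inter_left _ (hSQ n))
      _ = B * ∫⁻ x, a n x := by rw [← mul_add, lintegral_add_compl _ hZm]
      _ ≤ B * I := by
          gcongr
          rw [hI, ← hul2 0]
          exact lintegral_enorm_mollify_sq_le _ (hum 0)
  have hfatou := lintegral_le_liminf_of_ae_tendsto
    (H := fun n x => (S n).indicator (a n) x + B * Zᶜ.indicator (a n) x)
    (G := fun x => ‖u 0 x‖ₑ ^ 2 + B * Zᶜ.indicator (fun x => ‖u 0 x‖ₑ ^ 2) x)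
    (fun n => ((ham n).indicator (hSm n)).add (((ham n).indicator hZm.compl).const_mul B))
    (by
      filter_upwards [hind, hconv] with x hx1 hx2
      refine hx1.add (ENNReal.Tendsto.const_mul ?_ (Or.inr ENNReal.ofReal_ne_top))
      by_cases hxZ : x ∈ Zᶜ
      · simpa only [indicator_of_mem hxZ] using hx2
      · simp only [indicator_of_notMem hxZ]
        exact tendsto_const_nhds)
  have hle := hfatou.trans (Filter.liminf_le_of_frequently_le' hupper.frequently)
  have hu2 : AEMeasurable (fun x => ‖u 0 x‖ₑ ^ 2) volume := (hum 0).enorm.pow_const 2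
  rw [lintegral_add_left' hu2, lintegral_const_mul'' _ (hu2.indicator hZm.compl),
    lintegral_indicator hZm.compl, hul2 0, ← hI] at hle
  have hsplit : I = l2NormSq Z (w 0) + ∫⁻ x in Zᶜ, ‖u 0 x‖ₑ ^ 2 := by
    rw [hI, ← hul2 0, ← lintegral_add_compl _ hZm, l2NormSq_eq_lintegral]
    congr 1
    refine setLIntegral_congr_fun hZm fun x hx => ?_
    simp only [hu, indicator_of_mem hx.1]
  have hfin : B * ∫⁻ x in Zᶜ, ‖u 0 x‖ₑ ^ 2 ≠ ∞ := by
    refine ENNReal.mul_ne_top ENNReal.ofReal_ne_top (ne_top_of_le_ne_top hIfin ?_)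
    rw [hsplit]
    exact le_add_self
  have hle' : I + B * ∫⁻ x in Zᶜ, ‖u 0 x‖ₑ ^ 2 ≤
      B * l2NormSq Z (w 0) + B * ∫⁻ x in Zᶜ, ‖u 0 x‖ₑ ^ 2 := by
    rw [← mul_add, ← hsplit]
    exact hle
  exact (ENNReal.add_le_add_iff_right hfin).1 hle'

/-! ### From good cells to the whole domain -/

theorem hasWeakDerivOn_weakDeriv {d : ℕ} {Ω : Set (EuclideanSpace ℝ (Fin d))}
    (hΩ : IsOpen Ω) {f : EuclideanSpace ℝ (Fin d) → ℂ} (hf : MemSobolevWInfty Ω f)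
    (α : Fin d → ℕ) :
    HasWeakDerivOn Ω α f (weakDeriv Ω α f) ∧ MemLp (weakDeriv Ω α f) 2 (volume.restrict Ω) := by
  obtain ⟨g, hg2, hg⟩ := (hf (∑ i, α i)).2 α le_rfl
  have hex : ∃ g, HasWeakDerivOn Ω α f g := ⟨g, hg⟩
  have h1 : HasWeakDerivOn Ω α f (weakDeriv Ω α f) := by
    rw [weakDeriv, dif_pos hex]
    exact hex.choose_spec
  exact ⟨h1, (memLp_congr_ae (h1.ae_eq hΩ hg)).2 hg2⟩

theorem weakDeriv_zero_ae_eq {d : ℕ} {Ω : Set (EuclideanSpace ℝ (Fin d))}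
    (hΩ : IsOpen Ω) {f : EuclideanSpace ℝ (Fin d) → ℂ} (hf : MemSobolevWInfty Ω f) :
    weakDeriv Ω 0 f =ᵐ[volume.restrict Ω] f := by
  have h1 := (hasWeakDerivOn_weakDeriv hΩ hf 0).1
  refine h1.ae_eq hΩ ⟨h1.1, h1.1, fun φ _ _ _ => ?_⟩
  have h2 : multiDeriv (0 : Fin d → ℕ) φ = φ := by simp [multiDeriv]
  rw [h2]
  simp

theorem l2NormSq_congr_ae {d : ℕ} {S : Set (EuclideanSpace ℝ (Fin d))}
    {g g' : EuclideanSpace ℝ (Fin d) → ℂ} (h : g =ᵐ[volume.restrict S] g') :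
    l2NormSq S g = l2NormSq S g' := by
  unfold l2NormSq
  rw [eLpNorm_congr_ae h]

theorem l2NormSq_indicator {d : ℕ} (S : Set (EuclideanSpace ℝ (Fin d)))
    {ω : Set (EuclideanSpace ℝ (Fin d))} (hω : MeasurableSet ω)
    (g : EuclideanSpace ℝ (Fin d) → ℂ) : l2NormSq S (ω.indicator g) = l2NormSq (S ∩ ω) g := by
  unfold l2NormSq
  rw [eLpNorm_indicator_eq_eLpNorm_restrict hω, Measure.restrict_restrict hω, inter_comm]

theorem l2NormSq_mono {d : ℕ} {S S' : Set (EuclideanSpace ℝ (Fin d))} (h : S ⊆ S')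
    (g : EuclideanSpace ℝ (Fin d) → ℂ) : l2NormSq S g ≤ l2NormSq S' g := by
  unfold l2NormSq
  gcongr

theorem IsKappaCovering.l2NormSq_le_tsum {d : ℕ} {J : Type*} {κ : ℝ} {l : Fin d → ℝ}
    {Ω : Set (EuclideanSpace ℝ (Fin d))} {Q : J → Set (EuclideanSpace ℝ (Fin d))}
    (hQ : IsKappaCovering κ l Ω Q) (f : EuclideanSpace ℝ (Fin d) → ℂ) :
    l2NormSq Ω f ≤ ∑' j, l2NormSq (Q j) f := by
  have := hQ.countable
  simp only [l2NormSq_eq_lintegral]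
  calc _ ≤ ∫⁻ x in ⋃ j, Q j, ‖f x‖ₑ ^ 2 :=
        lintegral_mono' (Measure.restrict_mono_ae (ae_le_set.2 hQ.covers)) le_rfl
    _ ≤ _ := lintegral_iUnion_le _ _

/-- The factor 2 in M = 2√κ h contributes 4 to the exponent; with the extra 1 this is the 5 of the
theorem. -/
theorem log_two_mul_sqrt_mul {κ h : ℝ} (hκ : 1 ≤ κ) (hh : 1 ≤ h) :
    4 * (Real.log (2 * √κ * h) / Real.log 2) + 1 =
      2 * (Real.log κ / Real.log 2) + 4 * (Real.log h / Real.log 2) + 5 := by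
  have h1 : Real.log 2 ≠ 0 := (Real.log_pos one_lt_two).ne'
  have h2 : √κ ≠ 0 := (Real.sqrt_pos.2 (by linarith)).ne'
  rw [Real.log_mul (by positivity) (by positivity), Real.log_mul two_ne_zero h2,
    Real.log_sqrt (by linarith)]
  field_simp
  ring

theorem mainTheorem2 {d : ℕ} (hd : 1 ≤ d)
    (Ω : Set (EuclideanSpace ℝ (Fin d))) (hΩ : IsOpen Ω) (hΩc : IsConnected Ω)
    {J : Type*} (κ : ℝ) (hκ : 1 ≤ κ) (l : Fin d → ℝ) (hl : ∀ k, 0 < l k)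
    (Q : J → Set (EuclideanSpace ℝ (Fin d))) (hQ : IsKappaCovering κ l Ω Q)
    (f : EuclideanSpace ℝ (Fin d) → ℂ) (hf : MemSobolevWInfty Ω f)
    (C_B : ℕ → ℝ) (hC : ∀ m, 0 < C_B m) (hB : BernsteinInequality Ω C_B f)
    (hsum : Summable fun m : ℕ => √(C_B m) * ((10 * ∑ k, l k) ^ m / (m.factorial : ℝ)))
    (h : ℝ) (hh : h = ∑' m : ℕ, √(C_B m) * ((10 * ∑ k, l k) ^ m / (m.factorial : ℝ)))
    (ω : Set (EuclideanSpace ℝ (Fin d))) (hω : NullMeasurableSet ω volume) (hωΩ : ω ⊆ Ω)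
    (Ψ : J → (EuclideanSpace ℝ (Fin d) ≃ₗ[ℝ] EuclideanSpace ℝ (Fin d)))
    (ν : ℝ)
    (hν : ν = ⨅ j, (volume (Ψ j '' (Q j ∩ ω))).toReal / Metric.diam (Ψ j '' Q j) ^ d)
    (hνpos : 0 < ν) :
    l2NormSq Ω f ≤
      ENNReal.ofReal
          (κ / 6 * (24 * d * unitBallVolume d / ν) ^
            (2 * (Real.log κ / Real.log 2) + 4 * (Real.log h / Real.log 2) + 5)) *
        l2NormSq ω f := by
  set N := l2NormSq Ω f with hN
  rcases eq_or_ne N 0 with hN0 | hN0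
  · rw [hN0]; exact zero_le
  have hf2 : MemLp f 2 (volume.restrict Ω) := (hf 0).1
  have hNfin : N ≠ ∞ := ENNReal.pow_ne_top hf2.2.ne
  set w : (Fin d → ℕ) → EuclideanSpace ℝ (Fin d) → ℂ := fun α => weakDeriv Ω α f with hw
  have hwd : ∀ α, HasWeakDerivOn Ω α f (w α) := fun α => (hasWeakDerivOn_weakDeriv hΩ hf α).1
  have hw2 : ∀ α, MemLp (w α) 2 (volume.restrict Ω) := fun α =>
    (hasWeakDerivOn_weakDeriv hΩ hf α).2
  have hw0 : w 0 =ᵐ[volume.restrict Ω] f := weakDeriv_zero_ae_eq hΩ hf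
  have hw0S : ∀ S ⊆ Ω, l2NormSq S (w 0) = l2NormSq S f := fun S hS =>
    l2NormSq_congr_ae (ae_restrict_of_ae_restrict_of_subset hS hw0)
  -- The Bernstein inequality of order 0 compares ‖f‖² with itself.
  have hC0 : 1 ≤ C_B 0 := by
    have h1 := hB 0
    simp only [Finset.piAntidiag_zero, Finset.sum_singleton] at h1
    change _ * l2NormSq Ω (w 0) ≤ _ at h1
    rw [hw0S Ω le_rfl, ← hN] at h1
    have h2 : 1 * N ≤ ENNReal.ofReal (C_B 0) * N := by simpa using h1
    rw [ENNReal.mul_le_mul_iff_left hN0 hNfin] at h2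
    exact ENNReal.one_le_ofReal.1 h2
  have hl0 : 0 ≤ ∑ k, l k := Finset.sum_nonneg fun k _ => (hl k).le
  have hh1 : 1 ≤ h := by
    have h1 := hsum.le_tsum 0 fun m _ => by positivity
    rw [← hh] at h1
    simp only [pow_zero, Nat.factorial_zero, Nat.cast_one, div_one, mul_one] at h1
    exact (Real.one_le_sqrt.2 hC0).trans h1
  obtain ⟨ω', hω'ω, hω'm, hω'ae⟩ := hω.exists_measurable_subset_ae_eq
  set e := 2 * (Real.log κ / Real.log 2) + 4 * (Real.log h / Real.log 2) + 5 with he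
  have hd0 : (0 : ℝ) < d := by exact_mod_cast hd
  have hτ := unitBallVolume_pos d
  set B := ENNReal.ofReal (1 / 12 * (24 * d * unitBallVolume d / ν) ^ e) with hBdef
  -- Index `m` refers to order `m + 1`, here and in `G`.
  set A : ℕ → ℝ := fun m => 2 ^ (m + 2) * κ * (C_B (m + 1) / ((m + 1).factorial : ℝ)) with hA
  have hApos : ∀ m, 0 < A m := fun m => by
    have := hC (m + 1)
    positivity
  set G : ℕ → Set (EuclideanSpace ℝ (Fin d)) → ℝ≥0∞ := fun m S =>
    ∑ α ∈ Finset.piAntidiag (Finset.univ : Finset (Fin d)) (m + 1),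
      ENNReal.ofReal (1 / multiFactorial α) * l2NormSq S (w α) with hG
  have hgoodj : ∀ j, (∀ m, G m (Q j) ≤ ENNReal.ofReal (A m) * l2NormSq (Q j) (w 0)) →
      l2NormSq (Q j) f ≤ B * l2NormSq (Q j ∩ ω') f := by
    intro j hj
    have hQΩ := hQ.subset j
    set D := Metric.diam (Ψ j '' Q j) with hD
    have hνj : ν ≤ (volume (Ψ j '' (Q j ∩ ω))).toReal / D ^ d := by
      rw [hν]
      refine ciInf_le ⟨0, ?_⟩ j
      rintro _ ⟨i, rfl⟩
      exact div_nonneg ENNReal.toReal_nonneg (pow_nonneg Metric.diam_nonneg _)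
    -- A zero diameter would make the quotient 0 by the convention for division, against ν > 0.
    have hDne : D ≠ 0 := by
      intro h0
      rw [h0, zero_pow (by omega), div_zero] at hνj
      linarith
    have hDpos : 0 < D := lt_of_le_of_ne Metric.diam_nonneg (Ne.symm hDne)
    rw [le_div_iff₀ (by positivity)] at hνj
    have hvolω : volume (Ψ j '' (Q j ∩ ω)) = volume (Ψ j '' (Q j ∩ ω')) := by
      obtain ⟨c, -, -, hc⟩ := exists_volume_image_linearEquiv_eq (Ψ j)
      rw [hc, hc]
      congr 1
      exact measure_congr ((Filter.EventuallyEq.refl _ _).inter hω'ae.symm)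
    rw [hvolω] at hνj
    obtain ⟨p, hp⟩ := hQ.in_rectangle j
    have hbd : Bornology.IsBounded (Ψ j '' Q j) :=
      (Ψ j).toContinuousLinearEquiv.lipschitz.isBounded_image (hQ.bounded j)
    -- A constant `c < ν` gives the strict volume bound that survives shrinking the cell; continuity
    -- in `c` then recovers ν.
    have hloc : ∀ c ∈ Ioo 0 ν, l2NormSq (Q j) f ≤
        ENNReal.ofReal (1 / 12 * (24 * d * unitBallVolume d / c) ^ e) *
          l2NormSq (Q j ∩ ω') f := by
      intro c hc
      have h1 := l2NormSq_le_of_bernstein hd hΩ.measurableSet hQΩ (hQ.isOpen j) (hQ.convex j)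
        (hQ.bounded j) hω'm hwd
        (fun α => (hw2 α).mono_measure (Measure.restrict_mono_set _ hQΩ)) hC hC0 hl hκ hsum hh hh1
        hj hp (Ψ j) hc.1 hDpos
        (fun x hx y hy => Metric.dist_le_diam_of_mem hbd (mem_image_of_mem _ hx)
          (mem_image_of_mem _ hy)) (by
          have h2 : c * D ^ d < (volume (Ψ j '' (Q j ∩ ω'))).toReal :=
            lt_of_lt_of_le (mul_lt_mul_of_pos_right hc.2 (by positivity)) hνj
          have h3 : 0 < c * D ^ d := mul_pos hc.1 (by positivity)
          exact ((ENNReal.ofReal_lt_ofReal_iff (h3.trans h2)).2 h2).trans_le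
            ENNReal.ofReal_toReal_le)
      rwa [log_two_mul_sqrt_mul hκ hh1, hw0S _ hQΩ,
        hw0S _ (inter_subset_left.trans hQΩ)] at h1
    have hPfin : l2NormSq (Q j ∩ ω') f ≠ ∞ :=
      ne_top_of_le_ne_top hNfin (l2NormSq_mono (inter_subset_left.trans hQΩ) f)
    have htend : Filter.Tendsto (fun c : ℝ =>
        ENNReal.ofReal (1 / 12 * (24 * d * unitBallVolume d / c) ^ e) * l2NormSq (Q j ∩ ω') f)
        (nhdsWithin ν (Iio ν)) (nhds (B * l2NormSq (Q j ∩ ω') f)) := by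
      refine ENNReal.Tendsto.mul_const (ENNReal.tendsto_ofReal ?_) (Or.inr hPfin)
      have hca : ContinuousAt
          (fun c : ℝ => 1 / 12 * (24 * d * unitBallVolume d / c) ^ e) ν := by
        refine continuousAt_const.mul (ContinuousAt.rpow_const ?_ (Or.inl ?_))
        · exact continuousAt_const.div continuousAt_id hνpos.ne'
        · positivity
      exact hca.tendsto.mono_left nhdsWithin_le_nhds
    refine ge_of_tendsto htend ?_
    filter_upwards [Ioo_mem_nhdsLT hνpos] with c hc
    exact hloc c hc
  -- On a bad cell some order violates its threshold, and that single term already dominates ‖f‖²;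
  -- hence one inequality covers both kinds of cell.
  have hj : ∀ j, l2NormSq (Q j) f ≤
      B * l2NormSq (Q j ∩ ω') f + ∑' m, ENNReal.ofReal (A m)⁻¹ * G m (Q j) := by
    intro j
    by_cases hgood : ∀ m, G m (Q j) ≤ ENNReal.ofReal (A m) * l2NormSq (Q j) (w 0)
    · exact (hgoodj j hgood).trans le_self_add
    · push Not at hgood
      obtain ⟨m, hm⟩ := hgood
      rw [hw0S _ (hQ.subset j)] at hm
      refine le_trans ?_ le_add_self
      refine le_trans ?_ (ENNReal.le_tsum m)
      calc l2NormSq (Q j) f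
          = ENNReal.ofReal (A m)⁻¹ * (ENNReal.ofReal (A m) * l2NormSq (Q j) f) := by
            rw [← mul_assoc, ← ENNReal.ofReal_mul (inv_nonneg.2 (hApos m).le),
              inv_mul_cancel₀ (hApos m).ne', ENNReal.ofReal_one, one_mul]
        _ ≤ _ := by gcongr
  have hGsum : ∀ m, ∑' j, G m (Q j) ≤
      ENNReal.ofReal κ * (ENNReal.ofReal (C_B (m + 1) / ((m + 1).factorial : ℝ)) * N) := by
    intro m
    simp only [hG]
    rw [Summable.tsum_finsetSum fun _ _ => ENNReal.summable]
    calc _ ≤ ∑ α ∈ Finset.piAntidiag (Finset.univ : Finset (Fin d)) (m + 1),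
          ENNReal.ofReal (1 / multiFactorial α) * (ENNReal.ofReal κ * l2NormSq Ω (w α)) := by
          gcongr with α _
          rw [ENNReal.tsum_mul_left]
          gcongr
          exact hQ.overlap _ (hw2 α)
      _ = ENNReal.ofReal κ * ∑ α ∈ Finset.piAntidiag (Finset.univ : Finset (Fin d)) (m + 1),
          ENNReal.ofReal (1 / multiFactorial α) * l2NormSq Ω (w α) := by
          rw [Finset.mul_sum]
          exact Finset.sum_congr rfl fun α _ => mul_left_comm _ _ _
      _ ≤ _ := by
          gcongr
          exact hB (m + 1)
  -- The thresholds are chosen so that order `m + 1` contributes exactly `(1/2)^(m+2)`, with κ and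
  -- `C_B` cancelling.
  have hbad : ∑' j, ∑' m, ENNReal.ofReal (A m)⁻¹ * G m (Q j) ≤ ENNReal.ofReal (1 / 2) * N := by
    rw [ENNReal.tsum_comm]
    calc _ ≤ ∑' m : ℕ, ENNReal.ofReal (1 / 4 * (1 / 2) ^ m) * N := by
          refine ENNReal.tsum_le_tsum fun m => ?_
          rw [ENNReal.tsum_mul_left]
          refine (mul_le_mul_right (hGsum m) _).trans_eq ?_
          have hCm := hC (m + 1)
          rw [← mul_assoc, ← mul_assoc, ← ENNReal.ofReal_mul (inv_nonneg.2 (hApos m).le),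
            ← ENNReal.ofReal_mul (mul_nonneg (inv_nonneg.2 (hApos m).le) (by linarith))]
          congr 2
          simp only [hA, pow_add, one_div, inv_pow]
          have hκ0 : κ ≠ 0 := by linarith
          field_simp
          norm_num
      _ = _ := by
          rw [ENNReal.tsum_mul_right, ← ENNReal.ofReal_tsum_of_nonneg (fun m => by positivity)
            (summable_geometric_two.mul_left _), tsum_mul_left, tsum_geometric_two]
          norm_num
  have hω2 : ∑' j, l2NormSq (Q j ∩ ω') f ≤ ENNReal.ofReal κ * l2NormSq ω f := by
    have h1 := hQ.overlap (ω'.indicator f) (hf2.indicator hω'm)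
    simp only [l2NormSq_indicator _ hω'm] at h1
    refine h1.trans ?_
    gcongr
    exact l2NormSq_mono (inter_subset_right.trans hω'ω) f
  -- The bad half of `N`, which is finite, is absorbed into the left side.
  have hmain : ENNReal.ofReal (1 / 2) * N ≤ B * (ENNReal.ofReal κ * l2NormSq ω f) := by
    have h1 : N ≤ B * (ENNReal.ofReal κ * l2NormSq ω f) + ENNReal.ofReal (1 / 2) * N := by
      refine (hQ.l2NormSq_le_tsum f).trans ((ENNReal.tsum_le_tsum hj).trans ?_)
      rw [ENNReal.tsum_add, ENNReal.tsum_mul_left]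
      gcongr
    have h2 : N = ENNReal.ofReal (1 / 2) * N + ENNReal.ofReal (1 / 2) * N := by
      rw [← add_mul, ← ENNReal.ofReal_add (by norm_num) (by norm_num)]
      norm_num
    conv_lhs at h1 => rw [h2]
    exact (ENNReal.add_le_add_iff_right (ENNReal.mul_ne_top ENNReal.ofReal_ne_top hNfin)).1 h1
  calc N = ENNReal.ofReal 2 * (ENNReal.ofReal (1 / 2) * N) := by
        rw [← mul_assoc, ← ENNReal.ofReal_mul two_pos.le]
        norm_num
    _ ≤ ENNReal.ofReal 2 * (B * (ENNReal.ofReal κ * l2NormSq ω f)) := by gcongr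
    _ = _ := by
        have hb : 0 ≤ 1 / 12 * (24 * d * unitBallVolume d / ν) ^ e := by positivity
        rw [← mul_assoc, ← mul_assoc, hBdef, ← ENNReal.ofReal_mul two_pos.le,
          ← ENNReal.ofReal_mul (by positivity)]
        congr 2
        ring

end
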